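/- Let $G$ be a (finite-dimensional, real) Lie group, $H$ an abelian Lie group written additively, and let $G$ act smoothly on $H$ by group automorphisms. Let $\pi : G^4 \to H$ be a smooth map that is normalized, i.e. $\pi(g_1,g_2,g_3,g_4)=0$ whenever some $g_i=1$. Its coboundary is $$d\pi(g_1,\dots,g_5)= g_1\pi(g_2,g_3,g_4,g_5)-\pi(g_1g_2,g_3,g_4,g_5)+\pi(g_1,g_2g_3,g_4,g_5)-\pi(g_1,g_2,g_3g_4,g_5)+\pi(g_1,g_2,g_3,g_4g_5)-\pi(g_1,g_2,g_3,g_4),$$ and $\pi$ is a 4-cocycle if $d\pi=0$. Terminology. A *tricategory* has bicategories of morphisms, a composition pseudofunctor (composition at a 0-cell, written $f\cdot g$ in diagrammatic order), identities, an associator $a(f,g,h):(fg)h\Rightarrow f(gh)$ and unitors $l(f):1f\Rightarrow f$, $r(f):f1\Rightarrow f$ that are adjoint equivalences, an invertible modification (the pentagonator) from the three-step path $((fg)h)k\Rightarrow (f(gh))k\Rightarrow f((gh)k)\Rightarrow f(g(hk))$ to the two-step path $((fg)h)k\Rightarrow (fg)(hk)\Rightarrow f(g(hk))$, and invertible modifications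 (the triangulators) $\lambda: l\cdot 1\Rrightarrow l\circ a$, $\mu: r\cdot 1\Rrightarrow (1\cdot l)\circ a$, $\rho: r\Rrightarrow(1\cdot r)\circ a$, subject to the pentagonator identity (the associahedron of five composable morphisms commutes) and the two normalization axioms relating the pentagonator with the triangulators. It is *smooth* if its objects, morphisms, 2-morphisms and 3-morphisms form manifolds $T_0,T_1,T_2,T_3$, the spaces of composable cells are (embedded sub)manifolds, and all source, target, identity, composition and coherence maps are smooth. A *biadjoint biequivalence* on a morphism $f$ consists of a morphism $f^{-1}$ in the opposite direction, adjoint equivalences $\epsilon:f^{-1}f\Rightarrow 1$ and $\eta:1\Rightarrow ff^{-1}$, and invertible 3-morphisms $$\Phi:\ 1_f \Rrightarrow \bigl(f\Rightarrow 1f\Rightarrow (ff^{-1})f\Rightarrow f(f^{-1}f)\Rightarrow f1\Rightarrow f\bigr),$$ $$\Theta:\ 1_{f^{-1}}\Rrightarrow\bigl(f^{-1}\Rightarrow f^{-1}1\Rightarrow f^{-1}(ff^{-1})\Rightarrow(f^{-1}f)f^{-1}\Rightarrow 1f^{-1}\Rightarrow f^{-1}\bigr)$$ satisfying the swallowtail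 identity: the pasting of $\Phi\cdot 1_{1_{f^{-1}}}$, $\lambda^{-1}$, the pentagonator at $(f,f^{-1},f,f^{-1})$, $\mu$, $\rho$ (each with edges reversed as needed), naturality squares, and $1_{1_f}\cdot\Theta^{-1}$ is the identity 3-morphism of $\eta$ followed by $1_f\cdot 1_{f^{-1}}$. A *Lie 3-group* is a smooth tricategory with one object in which there are smooth maps choosing an inverse of every 3-morphism, a weak inverse (part of an adjoint equivalence) of every 2-morphism, and a biadjoint biequivalence on every morphism. Let $\mathrm{Brane}_\pi(G,H)$ be the following structure. There is one object; the morphisms are the elements of $G$, composed by multiplication, with identity $1$; the only 2-morphisms are the identities $1_g$, $g\in G$; the 3-morphisms are the pairs $(g,h)\in G\times H$, viewed as $h:1_g\Rrightarrow 1_g$. Composition of 3-morphisms at a 2-cell and at a 1-cell is addition in $H$, and composition at a 0-cell is $(g,h)\cdot(g',h')=(gg',h+gh')$. The associator, the unitors and the triangulators are trivial, and the pentagonator at $(g_1,g_2,g_3,g_4)$ is $\pi(g_1,g_2,g_3,g_4)$. The manifolds of objects, morphisms, 2-morphisms and 3-morphisms are a point, $G$, $G$ and $G\times H$. Then: 1.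 For all $g_1,\dots,g_5\in G$, the pentagonator identity holds in $\mathrm{Brane}_\pi(G,H)$ at $(g_1,\dots,g_5)$ if and only if $d\pi(g_1,\dots,g_5)=0$. 2. If $\pi$ is a 4-cocycle, then $\mathrm{Brane}_\pi(G,H)$ is a Lie 3-group: a smooth tricategory with one object in which all morphisms, 2-morphisms and 3-morphisms are weakly invertible. All its 2-morphisms are identities. The smooth choice of inverses can be made such that the adjoint equivalences on 2-morphisms have trivial unit and counit, and such that, for every $g\in G$, the biadjoint biequivalence on $g$ has $g^{-1}$ as its inverse morphism, trivial $\epsilon$ and $\eta$, and $$\Phi(g)=-\pi(g,g^{-1},g,g^{-1}),\qquad \Theta(g)=0;$$ in particular the swallowtail identity holds with these choices. -/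

import Mathlib

open CategoryTheory Bicategory
open scoped ContDiff
open scoped Pseudofunctor.StrongTrans CategoryTheory.Prod

universe u w v v₁ o w₁ w₂ w₃ v₂ v₃ u₁ u₂ u₃

namespace Tricat

section Bicategorical

variable {A : Type u₁} [Bicategory.{w₁, v₁} A] {B : Type u₂} [Bicategory.{w₂, v₂} B]
  {C : Type u₃} [Bicategory.{w₃, v₃} C]

/-- The pairing `x ↦ (F x, G x)` of two pseudofunctors. -/
def pairing (F : A ⥤ᵖ B) (G : A ⥤ᵖ C) : A ⥤ᵖ B × C where
  obj x := (F.obj x, G.obj x)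
  map f := F.map f ×ₘ G.map f
  map₂ η := F.map₂ η ×ₘ G.map₂ η
  mapId x := Iso.prod (F.mapId x) (G.mapId x)
  mapComp f g := Iso.prod (F.mapComp f g) (G.mapComp f g)

/-- The first projection, as a pseudofunctor. -/
def proj₁ : A × B ⥤ᵖ A where
  obj x := x.1
  map f := f.1
  map₂ η := η.1
  mapId _ := Iso.refl _
  mapComp _ _ := Iso.refl _

/-- The second projection, as a pseudofunctor. -/
def proj₂ : A × B ⥤ᵖ B where
  obj x := x.2
  map f := f.2
  map₂ η := η.2
  mapId _ := Iso.refl _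
  mapComp _ _ := Iso.refl _

/-- The pseudofunctor `x ↦ (a, x)`. -/
def insertLeft (a : A) : B ⥤ᵖ A × B where
  obj x := (a, x)
  map f := 𝟙 a ×ₘ f
  map₂ η := 𝟙 (𝟙 a) ×ₘ η
  mapId _ := Iso.refl _
  mapComp _ _ := Iso.prod (λ_ (𝟙 a)).symm (Iso.refl _)

/-- The pseudofunctor `x ↦ (x, b)`. -/
def insertRight (b : B) : A ⥤ᵖ A × B where
  obj x := (x, b)
  map f := f ×ₘ 𝟙 b
  map₂ η := η ×ₘ 𝟙 (𝟙 b)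
  mapId _ := Iso.refl _
  mapComp _ _ := Iso.prod (Iso.refl _) (λ_ (𝟙 b)).symm

variable {x y z x' y' z' : A}

/-- Vertical pasting of two squares that commute up to isomorphism. -/
def pasteSquares {p : x ⟶ x'} {q : y ⟶ y'} {r : z ⟶ z'} {s : x ⟶ y} {s' : x' ⟶ y'}
    {t : y ⟶ z} {t' : y' ⟶ z'} (σ : p ≫ s' ≅ s ≫ q) (τ : q ≫ t' ≅ t ≫ r) :
    p ≫ s' ≫ t' ≅ (s ≫ t) ≫ r :=
  (α_ p s' t').symm ≪≫ whiskerRightIso σ t' ≪≫ α_ s q t' ≪≫ whiskerLeftIso s τ ≪≫ (α_ s t r).symm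

/-- The square `p ≫ 𝟙 ≅ 𝟙 ≫ p`. -/
def idSquare (p : x ⟶ y) : p ≫ 𝟙 y ≅ 𝟙 x ≫ p := ρ_ p ≪≫ (λ_ p).symm

/-- Given a left inverse `s'` of `s` and a right inverse `t'` of `t`, both up to isomorphism, an
isomorphism `φ : s ≅ t` induces an isomorphism `s' ≅ t'`, namely
`s' ≅ s' ≫ t ≫ t' ≅ s' ≫ s ≫ t' ≅ t'`. -/
def inverseIso {s t : x ⟶ y} {s' t' : y ⟶ x} (e : s' ≫ s ≅ 𝟙 y) (n : 𝟙 x ≅ t ≫ t')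
    (φ : s ≅ t) : s' ≅ t' :=
  (ρ_ s').symm ≪≫ whiskerLeftIso s' n ≪≫ whiskerLeftIso s' (whiskerRightIso φ.symm t') ≪≫
    (α_ s' s t').symm ≪≫ whiskerRightIso e t' ≪≫ λ_ t'

/-- Cancelling on the left a 1-morphism `s` with a left inverse up to isomorphism. -/
def cancelLeft {s : x ⟶ y} {s' : y ⟶ x} (e : s' ≫ s ≅ 𝟙 y) {t t' : y ⟶ z}
    (φ : s ≫ t ≅ s ≫ t') : t ≅ t' :=
  (λ_ t).symm ≪≫ whiskerRightIso e.symm t ≪≫ α_ s' s t ≪≫ whiskerLeftIso s' φ ≪≫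
    (α_ s' s t').symm ≪≫ whiskerRightIso e t' ≪≫ λ_ t'

/-- Cancelling on the right a 1-morphism `s` with a right inverse up to isomorphism. -/
def cancelRight {s : y ⟶ z} {s' : z ⟶ y} (n : 𝟙 y ≅ s ≫ s') {t t' : x ⟶ y}
    (φ : t ≫ s ≅ t' ≫ s) : t ≅ t' :=
  (ρ_ t).symm ≪≫ whiskerLeftIso t n ≪≫ (α_ t s s').symm ≪≫ whiskerRightIso φ s' ≪≫
    α_ t' s s' ≪≫ whiskerLeftIso t' n.symm ≪≫ ρ_ t'

/-- The components of an isomorphism of strong transformations. -/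
def componentIso {F G : A ⥤ᵖ B} {η θ : F ⟶ G} (m : η ≅ θ) (x : A) : η.app x ≅ θ.app x where
  hom := m.hom.as.app x
  inv := m.inv.as.app x
  hom_inv_id := congrArg (fun k => k.as.app x) m.hom_inv_id
  inv_hom_id := congrArg (fun k => k.as.app x) m.inv_hom_id

/-- A weak inverse of a 1-morphism `α` of a bicategory: `inv` together with isomorphisms
`u : 𝟙 ≅ α ≫ inv` (the unit) and `e : inv ≫ α ≅ 𝟙` (the counit) satisfying the two zig-zag
identities, so that `(α, inv, e, u)` is an adjoint equivalence. -/
structure WeakInverse (α : x ⟶ y) where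
  inv : y ⟶ x
  adj : Bicategory.Adjunction α inv
  unit_isIso : IsIso adj.unit
  counit_isIso : IsIso adj.counit

end Bicategorical

/-- The composite `(f · g) · h` as a pseudofunctor of three variables. -/
def assocLeft {A₁ A₂ A₃ A₁₂ A₁₂₃ : Type v} [Bicategory.{w₁, w₂} A₁] [Bicategory.{w₁, w₂} A₂]
    [Bicategory.{w₁, w₂} A₃] [Bicategory.{w₁, w₂} A₁₂] [Bicategory.{w₁, w₂} A₁₂₃]
    (F : A₁ × A₂ ⥤ᵖ A₁₂) (G : A₁₂ × A₃ ⥤ᵖ A₁₂₃) : A₁ × A₂ × A₃ ⥤ᵖ A₁₂₃ :=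
  (pairing ((pairing proj₁ (proj₂.comp proj₁)).comp F) (proj₂.comp proj₂)).comp G

/-- The composite `f · (g · h)` as a pseudofunctor of three variables. -/
def assocRight {A₁ A₂ A₃ A₂₃ A₁₂₃ : Type v} [Bicategory.{w₁, w₂} A₁] [Bicategory.{w₁, w₂} A₂]
    [Bicategory.{w₁, w₂} A₃] [Bicategory.{w₁, w₂} A₂₃] [Bicategory.{w₁, w₂} A₁₂₃]
    (F : A₂ × A₃ ⥤ᵖ A₂₃) (G : A₁ × A₂₃ ⥤ᵖ A₁₂₃) : A₁ × A₂ × A₃ ⥤ᵖ A₁₂₃ :=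
  (pairing proj₁ (proj₂.comp F)).comp G

/-- The local bicategories, composition, associator and unitors of a tricategory. -/
structure TricategoryCore where
  Obj : Type o
  Hom : Obj → Obj → Type v
  [bicat : ∀ a b, Bicategory.{w₁, w₂} (Hom a b)]
  one : ∀ a, Hom a a
  comp : ∀ a b c, Hom a b × Hom b c ⥤ᵖ Hom a c
  assoc : ∀ a b c d, assocLeft (comp a b c) (comp a c d) ≌ assocRight (comp b c d) (comp a b d)
  lunit : ∀ a b,
    (insertLeft (B := Hom a b) (one a)).comp (comp a a b) ≌
      Pseudofunctor.id (Hom a b)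
  runit : ∀ a b,
    (insertRight (A := Hom a b) (one b)).comp (comp a b b) ≌
      Pseudofunctor.id (Hom a b)

attribute [instance] TricategoryCore.bicat

namespace TricategoryCore

variable {T : TricategoryCore.{v, o, w₁, w₂}} {a b c d e : T.Obj}

/-- Composition of morphisms at a 0-cell. -/
def comp₁ (f : T.Hom a b) (g : T.Hom b c) : T.Hom a c := (T.comp a b c).obj (f, g)

/-- Composition of 2-morphisms at a 0-cell. -/
def comp₂ {f f' : T.Hom a b} {g g' : T.Hom b c} (α : f ⟶ f') (β : g ⟶ g') :
    comp₁ f g ⟶ comp₁ f' g' := (T.comp a b c).map (α ×ₘ β)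

/-- Composition of 3-morphisms at a 0-cell. -/
def comp₃ {f f' : T.Hom a b} {g g' : T.Hom b c} {α α' : f ⟶ f'} {β β' : g ⟶ g'}
    (Γ : α ⟶ α') (Γ' : β ⟶ β') : comp₂ α β ⟶ comp₂ α' β' := (T.comp a b c).map₂ (Γ ×ₘ Γ')

infixr:95 " ⊙ " => comp₁
infixr:95 " ⊙₂ " => comp₂
infixr:95 " ⊙₃ " => comp₃

section Composition

variable {f f' f'' f₃ f₄ f₅ : T.Hom a b} {g g' g'' g₃ g₄ g₅ : T.Hom b c}

/-- The constraint `(α ≫ α') · (β ≫ β') ≅ (α · β) ≫ (α' · β')` of composition at a 0-cell. -/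
def compComp (α : f ⟶ f') (α' : f' ⟶ f'') (β : g ⟶ g') (β' : g' ⟶ g'') :
    (α ≫ α') ⊙₂ (β ≫ β') ≅ (α ⊙₂ β) ≫ (α' ⊙₂ β') :=
  (T.comp a b c).mapComp (α ×ₘ β) (α' ×ₘ β')

/-- The constraint `1 · 1 ≅ 1` of composition at a 0-cell. -/
def compId (f : T.Hom a b) (g : T.Hom b c) : 𝟙 f ⊙₂ 𝟙 g ≅ 𝟙 (f ⊙ g) :=
  (T.comp a b c).mapId (f, g)

/-- Composition at a 0-cell of invertible 3-morphisms. -/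
def isoComp {α α' : f ⟶ f'} {β β' : g ⟶ g'} (Γ : α ≅ α') (Γ' : β ≅ β') :
    α ⊙₂ β ≅ α' ⊙₂ β' :=
  (T.comp a b c).map₂Iso (Iso.prod Γ Γ')

/-- `(α ≫ α') · 1 ≅ (α · 1) ≫ (α' · 1)` -/
def distribR (α : f ⟶ f') (α' : f' ⟶ f'') (g : T.Hom b c) :
    (α ≫ α') ⊙₂ 𝟙 g ≅ (α ⊙₂ 𝟙 g) ≫ (α' ⊙₂ 𝟙 g) :=
  isoComp (Iso.refl _) (λ_ (𝟙 g)).symm ≪≫ compComp α α' (𝟙 g) (𝟙 g)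

/-- `1 · (β ≫ β') ≅ (1 · β) ≫ (1 · β')` -/
def distribL (f : T.Hom a b) (β : g ⟶ g') (β' : g' ⟶ g'') :
    𝟙 f ⊙₂ (β ≫ β') ≅ (𝟙 f ⊙₂ β) ≫ (𝟙 f ⊙₂ β') :=
  isoComp (λ_ (𝟙 f)).symm (Iso.refl _) ≪≫ compComp (𝟙 f) (𝟙 f) β β'

/-- `distribR` for three factors. -/
def distribR₃ (α₁ : f ⟶ f') (α₂ : f' ⟶ f'') (α₃ : f'' ⟶ f₃) (g : T.Hom b c) :
    (α₁ ≫ α₂ ≫ α₃) ⊙₂ 𝟙 g ≅ (α₁ ⊙₂ 𝟙 g) ≫ (α₂ ⊙₂ 𝟙 g) ≫ (α₃ ⊙₂ 𝟙 g) :=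
  distribR α₁ _ g ≪≫ whiskerLeftIso _ (distribR α₂ α₃ g)

/-- `distribL` for three factors. -/
def distribL₃ (f : T.Hom a b) (β₁ : g ⟶ g') (β₂ : g' ⟶ g'') (β₃ : g'' ⟶ g₃) :
    𝟙 f ⊙₂ (β₁ ≫ β₂ ≫ β₃) ≅ (𝟙 f ⊙₂ β₁) ≫ (𝟙 f ⊙₂ β₂) ≫ (𝟙 f ⊙₂ β₃) :=
  distribL f β₁ _ ≪≫ whiskerLeftIso _ (distribL f β₂ β₃)

/-- `distribR` for five factors. -/
def distribR₅ (α₁ : f ⟶ f') (α₂ : f' ⟶ f'') (α₃ : f'' ⟶ f₃) (α₄ : f₃ ⟶ f₄) (α₅ : f₄ ⟶ f₅)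
    (g : T.Hom b c) : (α₁ ≫ α₂ ≫ α₃ ≫ α₄ ≫ α₅) ⊙₂ 𝟙 g ≅
      (α₁ ⊙₂ 𝟙 g) ≫ (α₂ ⊙₂ 𝟙 g) ≫ (α₃ ⊙₂ 𝟙 g) ≫ (α₄ ⊙₂ 𝟙 g) ≫ (α₅ ⊙₂ 𝟙 g) :=
  distribR α₁ _ g ≪≫ whiskerLeftIso _ (distribR α₂ _ g ≪≫ whiskerLeftIso _ (distribR₃ α₃ α₄ α₅ g))

/-- `distribL` for five factors. -/
def distribL₅ (f : T.Hom a b) (β₁ : g ⟶ g') (β₂ : g' ⟶ g'') (β₃ : g'' ⟶ g₃) (β₄ : g₃ ⟶ g₄)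
    (β₅ : g₄ ⟶ g₅) : 𝟙 f ⊙₂ (β₁ ≫ β₂ ≫ β₃ ≫ β₄ ≫ β₅) ≅
      (𝟙 f ⊙₂ β₁) ≫ (𝟙 f ⊙₂ β₂) ≫ (𝟙 f ⊙₂ β₃) ≫ (𝟙 f ⊙₂ β₄) ≫ (𝟙 f ⊙₂ β₅) :=
  distribL f β₁ _ ≪≫ whiskerLeftIso _ (distribL f β₂ _ ≪≫ whiskerLeftIso _ (distribL₃ f β₃ β₄ β₅))

/-- `(1 · β) ≫ (α · 1) ≅ (α · 1) ≫ (1 · β)` -/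
def interchange (α : f ⟶ f') (β : g ⟶ g') :
    (𝟙 f ⊙₂ β) ≫ (α ⊙₂ 𝟙 g') ≅ (α ⊙₂ 𝟙 g) ≫ (𝟙 f' ⊙₂ β) :=
  (compComp (𝟙 f) α β (𝟙 g')).symm ≪≫
    isoComp (λ_ α ≪≫ (ρ_ α).symm) (ρ_ β ≪≫ (λ_ β).symm) ≪≫ compComp α (𝟙 f') (𝟙 g) β

/-- Composition at a 0-cell of two squares that commute up to isomorphism. -/
def squareComp {p₁ p₂ q₁ q₂ : T.Hom a b} {r₁ r₂ s₁ s₂ : T.Hom b c}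
    {α : p₁ ⟶ p₂} {α' : q₁ ⟶ q₂} {x : p₁ ⟶ q₁} {x' : p₂ ⟶ q₂}
    {β : r₁ ⟶ r₂} {β' : s₁ ⟶ s₂} {y : r₁ ⟶ s₁} {y' : r₂ ⟶ s₂}
    (σ : α ≫ x' ≅ x ≫ α') (τ : β ≫ y' ≅ y ≫ β') :
    (α ⊙₂ β) ≫ (x' ⊙₂ y') ≅ (x ⊙₂ y) ≫ (α' ⊙₂ β') :=
  (compComp α x' β y').symm ≪≫ isoComp σ τ ≪≫ compComp x α' y β'

end Composition

section Associator

/-- The associator. -/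
def asc (f : T.Hom a b) (g : T.Hom b c) (h : T.Hom c d) : (f ⊙ g) ⊙ h ⟶ f ⊙ (g ⊙ h) :=
  (T.assoc a b c d).hom.app (f, g, h)

/-- The weak inverse of the associator. -/
def ascInv (f : T.Hom a b) (g : T.Hom b c) (h : T.Hom c d) : f ⊙ (g ⊙ h) ⟶ (f ⊙ g) ⊙ h :=
  (T.assoc a b c d).inv.app (f, g, h)

def ascUnit (f : T.Hom a b) (g : T.Hom b c) (h : T.Hom c d) :
    𝟙 ((f ⊙ g) ⊙ h) ≅ asc f g h ≫ ascInv f g h :=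
  componentIso (T.assoc a b c d).unit (f, g, h)

def ascCounit (f : T.Hom a b) (g : T.Hom b c) (h : T.Hom c d) :
    ascInv f g h ≫ asc f g h ≅ 𝟙 (f ⊙ (g ⊙ h)) :=
  componentIso (T.assoc a b c d).counit (f, g, h)

variable {f f' : T.Hom a b} {g g' : T.Hom b c} {h h' : T.Hom c d}

/-- The naturality square of the associator. -/
def ascNat (α : f ⟶ f') (β : g ⟶ g') (γ : h ⟶ h') :
    ((α ⊙₂ β) ⊙₂ γ) ≫ asc f' g' h' ≅ asc f g h ≫ (α ⊙₂ (β ⊙₂ γ)) :=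
  (T.assoc a b c d).hom.naturality (α ×ₘ β ×ₘ γ)

/-- The naturality square of the weak inverse of the associator. -/
def ascInvNat (α : f ⟶ f') (β : g ⟶ g') (γ : h ⟶ h') :
    (α ⊙₂ (β ⊙₂ γ)) ≫ ascInv f' g' h' ≅ ascInv f g h ≫ ((α ⊙₂ β) ⊙₂ γ) :=
  (T.assoc a b c d).inv.naturality (α ×ₘ β ×ₘ γ)

end Associator

section Unitors

/-- The left unitor. -/
def lun (f : T.Hom a b) : T.one a ⊙ f ⟶ f := (T.lunit a b).hom.app f

/-- The weak inverse of the left unitor. -/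
def lunInv (f : T.Hom a b) : f ⟶ T.one a ⊙ f := (T.lunit a b).inv.app f

def lunUnit (f : T.Hom a b) : 𝟙 (T.one a ⊙ f) ≅ lun f ≫ lunInv f :=
  componentIso (T.lunit a b).unit f

def lunCounit (f : T.Hom a b) : lunInv f ≫ lun f ≅ 𝟙 f :=
  componentIso (T.lunit a b).counit f

/-- The right unitor. -/
def run (f : T.Hom a b) : f ⊙ T.one b ⟶ f := (T.runit a b).hom.app f

/-- The weak inverse of the right unitor. -/
def runInv (f : T.Hom a b) : f ⟶ f ⊙ T.one b := (T.runit a b).inv.app f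

def runUnit (f : T.Hom a b) : 𝟙 (f ⊙ T.one b) ≅ run f ≫ runInv f :=
  componentIso (T.runit a b).unit f

def runCounit (f : T.Hom a b) : runInv f ≫ run f ≅ 𝟙 f :=
  componentIso (T.runit a b).counit f

variable {f f' : T.Hom a b} (α : f ⟶ f')

def lunNat : (𝟙 (T.one a) ⊙₂ α) ≫ lun f' ≅ lun f ≫ α := (T.lunit a b).hom.naturality α

def lunInvNat : α ≫ lunInv f' ≅ lunInv f ≫ (𝟙 (T.one a) ⊙₂ α) := (T.lunit a b).inv.naturality α

def runNat : (α ⊙₂ 𝟙 (T.one b)) ≫ run f' ≅ run f ≫ α := (T.runit a b).hom.naturality α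

def runInvNat : α ≫ runInv f' ≅ runInv f ≫ (α ⊙₂ 𝟙 (T.one b)) := (T.runit a b).inv.naturality α

end Unitors

end TricategoryCore

open TricategoryCore

/-- The data of a tricategory: local bicategories, composition, associator and unitors, together
with the pentagonator `pent` and the left, middle and right triangulators `lam`, `mu` and `rho`. -/
structure Pretricategory where
  core : TricategoryCore.{v, o, w₁, w₂}
  pent : ∀ {a b c d e : core.Obj} (f : core.Hom a b) (g : core.Hom b c) (h : core.Hom c d)
    (k : core.Hom d e),
    (asc f g h ⊙₂ 𝟙 k) ≫ asc f (g ⊙ h) k ≫ (𝟙 f ⊙₂ asc g h k) ≅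
      asc (f ⊙ g) h k ≫ asc f g (h ⊙ k)
  lam : ∀ {a b c : core.Obj} (f : core.Hom a b) (g : core.Hom b c),
    lun f ⊙₂ 𝟙 g ≅ asc (core.one a) f g ≫ lun (f ⊙ g)
  mu : ∀ {a b c : core.Obj} (f : core.Hom a b) (g : core.Hom b c),
    run f ⊙₂ 𝟙 g ≅ asc f (core.one b) g ≫ (𝟙 f ⊙₂ lun g)
  rho : ∀ {a b c : core.Obj} (f : core.Hom a b) (g : core.Hom b c),
    run (f ⊙ g) ≅ asc f g (core.one c) ≫ (𝟙 f ⊙₂ run g)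

namespace Pretricategory

variable (P : Pretricategory.{v, o, w₁, w₂}) {a b c d e e' : P.core.Obj}

section Modifications

/-- The pentagonator is a modification. -/
def PentNatural : Prop :=
  ∀ {a b c d e : P.core.Obj} {f f' : P.core.Hom a b} {g g' : P.core.Hom b c}
    {h h' : P.core.Hom c d} {k k' : P.core.Hom d e} (α : f ⟶ f') (β : g ⟶ g') (γ : h ⟶ h')
    (δ : k ⟶ k'),
    ((α ⊙₂ β) ⊙₂ γ) ⊙₂ δ ◁ (P.pent f' g' h' k').hom ≫
        (pasteSquares (ascNat (α ⊙₂ β) γ δ) (ascNat α β (γ ⊙₂ δ))).hom =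
      (pasteSquares (squareComp (ascNat α β γ) (idSquare δ))
          (pasteSquares (ascNat α (β ⊙₂ γ) δ) (squareComp (idSquare α) (ascNat β γ δ)))).hom ≫
        (P.pent f g h k).hom ▷ (α ⊙₂ (β ⊙₂ (γ ⊙₂ δ)))

/-- The left triangulator is a modification. -/
def LamNatural : Prop :=
  ∀ {a b c : P.core.Obj} {f f' : P.core.Hom a b} {g g' : P.core.Hom b c} (α : f ⟶ f')
    (β : g ⟶ g'),
    (𝟙 (P.core.one a) ⊙₂ α) ⊙₂ β ◁ (P.lam f' g').hom ≫
        (pasteSquares (ascNat (𝟙 (P.core.one a)) α β) (lunNat (α ⊙₂ β))).hom =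
      (squareComp (lunNat α) (idSquare β)).hom ≫ (P.lam f g).hom ▷ (α ⊙₂ β)

/-- The middle triangulator is a modification. -/
def MuNatural : Prop :=
  ∀ {a b c : P.core.Obj} {f f' : P.core.Hom a b} {g g' : P.core.Hom b c} (α : f ⟶ f')
    (β : g ⟶ g'),
    (α ⊙₂ 𝟙 (P.core.one b)) ⊙₂ β ◁ (P.mu f' g').hom ≫
        (pasteSquares (ascNat α (𝟙 (P.core.one b)) β)
          (squareComp (idSquare α) (lunNat β))).hom =
      (squareComp (runNat α) (idSquare β)).hom ≫ (P.mu f g).hom ▷ (α ⊙₂ β)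

/-- The right triangulator is a modification. -/
def RhoNatural : Prop :=
  ∀ {a b c : P.core.Obj} {f f' : P.core.Hom a b} {g g' : P.core.Hom b c} (α : f ⟶ f')
    (β : g ⟶ g'),
    (α ⊙₂ β) ⊙₂ 𝟙 (P.core.one c) ◁ (P.rho f' g').hom ≫
        (pasteSquares (ascNat α β (𝟙 (P.core.one c)))
          (squareComp (idSquare α) (runNat β))).hom =
      (runNat (α ⊙₂ β)).hom ≫ (P.rho f g).hom ▷ (α ⊙₂ β)

end Modifications

variable {P}

section Axioms

variable (f : P.core.Hom a b) (g : P.core.Hom b c) (h : P.core.Hom c d) (k : P.core.Hom d e)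
  (p : P.core.Hom e e')

/-- The face `π · 1` of the associahedron. -/
def pentComp :
    ((asc f g h ⊙₂ 𝟙 k) ⊙₂ 𝟙 p) ≫ (asc f (g ⊙ h) k ⊙₂ 𝟙 p) ≫ ((𝟙 f ⊙₂ asc g h k) ⊙₂ 𝟙 p) ≅
      (asc (f ⊙ g) h k ⊙₂ 𝟙 p) ≫ (asc f g (h ⊙ k) ⊙₂ 𝟙 p) :=
  (distribR₃ _ _ _ p).symm ≪≫ isoComp (P.pent f g h k) (Iso.refl (𝟙 p)) ≪≫ distribR _ _ p

/-- The face `1 · π` of the associahedron. -/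
def compPent :
    (𝟙 f ⊙₂ (asc g h k ⊙₂ 𝟙 p)) ≫ (𝟙 f ⊙₂ asc g (h ⊙ k) p) ≫ (𝟙 f ⊙₂ (𝟙 g ⊙₂ asc h k p)) ≅
      (𝟙 f ⊙₂ asc (g ⊙ h) k p) ≫ (𝟙 f ⊙₂ asc g h (k ⊙ p)) :=
  (distribL₃ f _ _ _).symm ≪≫ isoComp (Iso.refl (𝟙 f)) (P.pent g h k p) ≪≫ distribL f _ _

/-- The back of the associahedron, from `(((fg)h)k)p` to `f(g(h(kp)))`. -/
def associahedronBack :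
    ((asc f g h ⊙₂ 𝟙 k) ⊙₂ 𝟙 p) ≫ (asc f (g ⊙ h) k ⊙₂ 𝟙 p) ≫ ((𝟙 f ⊙₂ asc g h k) ⊙₂ 𝟙 p) ≫
        asc f (g ⊙ (h ⊙ k)) p ≫ (𝟙 f ⊙₂ asc g (h ⊙ k) p) ≫ (𝟙 f ⊙₂ (𝟙 g ⊙₂ asc h k p)) ⟶
      asc ((f ⊙ g) ⊙ h) k p ≫ asc (f ⊙ g) h (k ⊙ p) ≫ asc f g (h ⊙ (k ⊙ p)) :=
  𝟙 _ ⊗≫ (pentComp f g h k p).hom ▷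
      (asc f (g ⊙ (h ⊙ k)) p ≫ (𝟙 f ⊙₂ asc g (h ⊙ k) p) ≫ (𝟙 f ⊙₂ (𝟙 g ⊙₂ asc h k p))) ⊗≫
    (asc (f ⊙ g) h k ⊙₂ 𝟙 p) ◁ (P.pent f g (h ⊙ k) p).hom ▷ (𝟙 f ⊙₂ (𝟙 g ⊙₂ asc h k p)) ⊗≫
    ((asc (f ⊙ g) h k ⊙₂ 𝟙 p) ≫ asc (f ⊙ g) (h ⊙ k) p) ◁
      (ascNat (𝟙 f) (𝟙 g) (asc h k p)).inv ⊗≫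
    ((asc (f ⊙ g) h k ⊙₂ 𝟙 p) ≫ asc (f ⊙ g) (h ⊙ k) p) ◁
      (isoComp (compId f g) (Iso.refl (asc h k p))).hom ▷ asc f g (h ⊙ (k ⊙ p)) ⊗≫
    (P.pent (f ⊙ g) h k p).hom ▷ asc f g (h ⊙ (k ⊙ p)) ⊗≫ 𝟙 _

/-- The front of the associahedron, from `(((fg)h)k)p` to `f(g(h(kp)))`. -/
def associahedronFront :
    ((asc f g h ⊙₂ 𝟙 k) ⊙₂ 𝟙 p) ≫ (asc f (g ⊙ h) k ⊙₂ 𝟙 p) ≫ ((𝟙 f ⊙₂ asc g h k) ⊙₂ 𝟙 p) ≫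
        asc f (g ⊙ (h ⊙ k)) p ≫ (𝟙 f ⊙₂ asc g (h ⊙ k) p) ≫ (𝟙 f ⊙₂ (𝟙 g ⊙₂ asc h k p)) ⟶
      asc ((f ⊙ g) ⊙ h) k p ≫ asc (f ⊙ g) h (k ⊙ p) ≫ asc f g (h ⊙ (k ⊙ p)) :=
  𝟙 _ ⊗≫ (((asc f g h ⊙₂ 𝟙 k) ⊙₂ 𝟙 p) ≫ (asc f (g ⊙ h) k ⊙₂ 𝟙 p)) ◁
      (ascNat (𝟙 f) (asc g h k) (𝟙 p)).hom ▷
        ((𝟙 f ⊙₂ asc g (h ⊙ k) p) ≫ (𝟙 f ⊙₂ (𝟙 g ⊙₂ asc h k p))) ⊗≫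
    (((asc f g h ⊙₂ 𝟙 k) ⊙₂ 𝟙 p) ≫ (asc f (g ⊙ h) k ⊙₂ 𝟙 p) ≫ asc f ((g ⊙ h) ⊙ k) p) ◁
      (compPent f g h k p).hom ⊗≫
    ((asc f g h ⊙₂ 𝟙 k) ⊙₂ 𝟙 p) ◁ (P.pent f (g ⊙ h) k p).hom ▷ (𝟙 f ⊙₂ asc g h (k ⊙ p)) ⊗≫
    (ascNat (asc f g h) (𝟙 k) (𝟙 p)).hom ▷
      (asc f (g ⊙ h) (k ⊙ p) ≫ (𝟙 f ⊙₂ asc g h (k ⊙ p))) ⊗≫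
    asc ((f ⊙ g) ⊙ h) k p ◁ (isoComp (Iso.refl (asc f g h)) (compId k p)).hom ▷
      (asc f (g ⊙ h) (k ⊙ p) ≫ (𝟙 f ⊙₂ asc g h (k ⊙ p))) ⊗≫
    asc ((f ⊙ g) ⊙ h) k p ◁ (P.pent f g h (k ⊙ p)).hom ⊗≫ 𝟙 _

/-- The pentagonator identity at five composable morphisms: the associahedron commutes. -/
def PentagonatorIdentity : Prop := associahedronBack f g h k p = associahedronFront f g h k p

/-- The left normalization axiom, relating `pent f 1 g h` with `mu` and `lam`: the two pastings
from `((f1)g)h` to `f(gh)` agree. -/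
def LeftNormalization (f : P.core.Hom a b) (g : P.core.Hom b c) (h : P.core.Hom c d) : Prop :=
  (𝟙 _ ⊗≫ (P.pent f (P.core.one b) g h).hom ▷ (𝟙 f ⊙₂ lun (g ⊙ h)) ⊗≫
    asc (f ⊙ P.core.one b) g h ◁ (P.mu f (g ⊙ h)).inv ⊗≫
    asc (f ⊙ P.core.one b) g h ◁ (isoComp (Iso.refl (run f)) (compId g h)).inv ⊗≫
    (ascNat (run f) (𝟙 g) (𝟙 h)).inv :
      (asc f (P.core.one b) g ⊙₂ 𝟙 h) ≫ asc f (P.core.one b ⊙ g) h ≫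
        (𝟙 f ⊙₂ asc (P.core.one b) g h) ≫ (𝟙 f ⊙₂ lun (g ⊙ h)) ⟶
      ((run f ⊙₂ 𝟙 g) ⊙₂ 𝟙 h) ≫ asc f g h) =
  𝟙 _ ⊗≫ ((asc f (P.core.one b) g ⊙₂ 𝟙 h) ≫ asc f (P.core.one b ⊙ g) h) ◁
      ((distribL f (asc (P.core.one b) g h) (lun (g ⊙ h))).symm ≪≫
        isoComp (Iso.refl (𝟙 f)) (P.lam g h).symm).hom ⊗≫
    (asc f (P.core.one b) g ⊙₂ 𝟙 h) ◁ (ascNat (𝟙 f) (lun g) (𝟙 h)).inv ⊗≫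
    ((distribR (asc f (P.core.one b) g) (𝟙 f ⊙₂ lun g) h).symm ≪≫
      isoComp (P.mu f g).symm (Iso.refl (𝟙 h))).hom ▷ asc f g h

/-- The right normalization axiom, relating `pent f g 1 h` with `mu` and `rho`: the two pastings
from `((fg)1)h` to `f(gh)` agree. -/
def RightNormalization (f : P.core.Hom a b) (g : P.core.Hom b c) (h : P.core.Hom c d) : Prop :=
  (𝟙 _ ⊗≫ (P.pent f g (P.core.one c) h).hom ▷ (𝟙 f ⊙₂ (𝟙 g ⊙₂ lun h)) ⊗≫
    asc (f ⊙ g) (P.core.one c) h ◁ (ascNat (𝟙 f) (𝟙 g) (lun h)).inv ⊗≫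
    asc (f ⊙ g) (P.core.one c) h ◁ (isoComp (compId f g) (Iso.refl (lun h))).hom ▷ asc f g h ⊗≫
    (P.mu (f ⊙ g) h).inv ▷ asc f g h :
      (asc f g (P.core.one c) ⊙₂ 𝟙 h) ≫ asc f (g ⊙ P.core.one c) h ≫
        (𝟙 f ⊙₂ asc g (P.core.one c) h) ≫ (𝟙 f ⊙₂ (𝟙 g ⊙₂ lun h)) ⟶
      (run (f ⊙ g) ⊙₂ 𝟙 h) ≫ asc f g h) =
  𝟙 _ ⊗≫ ((asc f g (P.core.one c) ⊙₂ 𝟙 h) ≫ asc f (g ⊙ P.core.one c) h) ◁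
      ((distribL f (asc g (P.core.one c) h) (𝟙 g ⊙₂ lun h)).symm ≪≫
        isoComp (Iso.refl (𝟙 f)) (P.mu g h).symm).hom ⊗≫
    (asc f g (P.core.one c) ⊙₂ 𝟙 h) ◁ (ascNat (𝟙 f) (run g) (𝟙 h)).inv ⊗≫
    ((distribR (asc f g (P.core.one c)) (𝟙 f ⊙₂ run g) h).symm ≪≫
      isoComp (P.rho f g).symm (Iso.refl (𝟙 h))).hom ▷ asc f g h

end Axioms

variable (P) in
/-- The axioms of a tricategory. -/
structure IsTricategory : Prop where
  pentNatural : P.PentNatural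
  lamNatural : P.LamNatural
  muNatural : P.MuNatural
  rhoNatural : P.RhoNatural
  pentagonatorIdentity : ∀ {a b c d e e' : P.core.Obj} (f : P.core.Hom a b) (g : P.core.Hom b c)
    (h : P.core.Hom c d) (k : P.core.Hom d e) (p : P.core.Hom e e'),
    PentagonatorIdentity f g h k p
  leftNormalization : ∀ {a b c d : P.core.Obj} (f : P.core.Hom a b) (g : P.core.Hom b c)
    (h : P.core.Hom c d), LeftNormalization f g h
  rightNormalization : ∀ {a b c d : P.core.Obj} (f : P.core.Hom a b) (g : P.core.Hom b c)
    (h : P.core.Hom c d), RightNormalization f g h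

section Biadjoint

variable (f : P.core.Hom a b) (g : P.core.Hom b a)

/-- The left and right unitors at an identity morphism are canonically isomorphic. -/
def lunIsoRun (P : Pretricategory.{v, o, w₁, w₂}) (a : P.core.Obj) :
    lun (P.core.one a) ≅ run (P.core.one a) :=
  cancelLeft (runCounit (P.core.one a ⊙ P.core.one a))
    ((runNat (lun (P.core.one a))).symm ≪≫
      whiskerRightIso
        (P.lam (P.core.one a) (P.core.one a) ≪≫
          whiskerLeftIso _ (cancelRight (lunUnit (P.core.one a)) (lunNat (lun (P.core.one a)))).symm
            ≪≫ (P.mu (P.core.one a) (P.core.one a)).symm)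
        (run (P.core.one a)) ≪≫
      runNat (run (P.core.one a)))

/-- The isomorphism between the weak inverses of the unitors induced by `lunIsoRun`. -/
def lunInvIsoRunInv (P : Pretricategory.{v, o, w₁, w₂}) (a : P.core.Obj) :
    lunInv (P.core.one a) ≅ runInv (P.core.one a) :=
  inverseIso (lunCounit (P.core.one a)) (runUnit (P.core.one a)) (lunIsoRun P a)

/-- `𝟙 ≅ (s ≫ t) ≫ (t' ≫ s')` for right inverses `s'` of `s` and `t'` of `t`. -/
def compUnit {X : Type v} [Bicategory.{w₁, w₂} X] {x y z : X} {s : x ⟶ y} {t : y ⟶ z}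
    {s' : y ⟶ x} {t' : z ⟶ y} (m : 𝟙 x ≅ s ≫ s') (n : 𝟙 y ≅ t ≫ t') :
    𝟙 x ≅ (s ≫ t) ≫ (t' ≫ s') :=
  m ≪≫ whiskerLeftIso s ((λ_ s').symm ≪≫ whiskerRightIso n s' ≪≫ α_ t t' s') ≪≫
    (α_ s t (t' ≫ s')).symm

/-- The left triangulator with its edges reversed. -/
def lamInv {c : P.core.Obj} (f : P.core.Hom a b) (g : P.core.Hom b c) :
    lunInv f ⊙₂ 𝟙 g ≅ lunInv (f ⊙ g) ≫ ascInv (P.core.one a) f g :=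
  inverseIso
    ((distribR (lunInv f) (lun f) g).symm ≪≫ isoComp (lunCounit f) (Iso.refl (𝟙 g)) ≪≫ compId f g)
    (compUnit (ascUnit (P.core.one a) f g) (lunUnit (f ⊙ g))) (P.lam f g)

/-- `𝟙 ≅ (1 · θ) ≫ (1 · θ')` for a right inverse `θ'` of `θ`. -/
def compUnitL {c : P.core.Obj} (f : P.core.Hom a b) {x y : P.core.Hom b c} {θ : x ⟶ y} {θ' : y ⟶ x}
    (n : 𝟙 x ≅ θ ≫ θ') : 𝟙 (f ⊙ x) ≅ (𝟙 f ⊙₂ θ) ≫ (𝟙 f ⊙₂ θ') :=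
  (compId f x).symm ≪≫ isoComp (Iso.refl (𝟙 f)) n ≪≫ distribL f θ θ'

/-- The right triangulator with some edges reversed:
`r' ≫ a ≅ r' ≫ a ≫ (1 · r) ≫ (1 · r') ≅ r' ≫ r ≫ (1 · r') ≅ 1 · r'`. -/
def rhoOne {c : P.core.Obj} (f : P.core.Hom a b) (g : P.core.Hom b c) :
    runInv (f ⊙ g) ≫ asc f g (P.core.one c) ≅ 𝟙 f ⊙₂ runInv g :=
  whiskerLeftIso _ ((ρ_ _).symm ≪≫ whiskerLeftIso _ (compUnitL f (runUnit g)) ≪≫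
      (α_ _ _ _).symm ≪≫ whiskerRightIso (P.rho f g).symm _) ≪≫
    (α_ _ _ _).symm ≪≫ whiskerRightIso (runCounit (f ⊙ g)) _ ≪≫ λ_ _

/-- The pentagonator with some edges reversed, from `(fg)(hk)` to `f((gh)k)`. -/
def pentOne {c d e : P.core.Obj} (f : P.core.Hom a b) (g : P.core.Hom b c) (h : P.core.Hom c d)
    (k : P.core.Hom d e) :
    ascInv (f ⊙ g) h k ≫ (asc f g h ⊙₂ 𝟙 k) ≫ asc f (g ⊙ h) k ≅
      asc f g (h ⊙ k) ≫ (𝟙 f ⊙₂ ascInv g h k) :=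
  whiskerLeftIso (ascInv (f ⊙ g) h k)
      ((ρ_ _).symm ≪≫ whiskerLeftIso _ (compUnitL f (ascUnit g h k)) ≪≫ (α_ _ _ _).symm ≪≫
        whiskerRightIso (α_ _ _ _ ≪≫ P.pent f g h k) _ ≪≫ α_ _ _ _) ≪≫
    (α_ _ _ _).symm ≪≫ whiskerRightIso (ascCounit (f ⊙ g) h k) _ ≪≫ λ_ _

/-- The 2-morphism `f ⟶ 1f ⟶ (fg)f ⟶ f(gf) ⟶ f1 ⟶ f` of the first zig-zag identity. -/
abbrev zigzag₁ (ev : g ⊙ f ⟶ P.core.one b) (η : P.core.one a ⟶ f ⊙ g) : f ⟶ f :=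
  lunInv f ≫ (η ⊙₂ 𝟙 f) ≫ asc f g f ≫ (𝟙 f ⊙₂ ev) ≫ run f

/-- The 2-morphism `g ⟶ g1 ⟶ g(fg) ⟶ (gf)g ⟶ 1g ⟶ g` of the second zig-zag identity. -/
abbrev zigzag₂ (ev : g ⊙ f ⟶ P.core.one b) (η : P.core.one a ⟶ f ⊙ g) : g ⟶ g :=
  runInv g ≫ (𝟙 g ⊙₂ η) ≫ ascInv g f g ≫ (ev ⊙₂ 𝟙 g) ≫ lun g

/-- The left-hand side of the swallowtail identity: the pasting, from left to right, of the faces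
`Φ · 1`, `lam⁻¹`, the naturality squares, `pentOne`, `mu`, `rhoOne` and `1 · Θ⁻¹`. -/
def swallowtail (ev : g ⊙ f ⟶ P.core.one b) (η : P.core.one a ⟶ f ⊙ g)
    (Φ : 𝟙 f ≅ zigzag₁ f g ev η) (Θ : 𝟙 g ≅ zigzag₂ f g ev η) :
    η ≫ (𝟙 f ⊙₂ 𝟙 g) ⟶ η ≫ (𝟙 f ⊙₂ 𝟙 g) :=
  η ◁ (isoComp Φ (Iso.refl (𝟙 g)) ≪≫
      distribR₅ (lunInv f) (η ⊙₂ 𝟙 f) (asc f g f) (𝟙 f ⊙₂ ev) (run f) g).hom ⊗≫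
    η ◁ (lamInv f g).hom ▷ (((η ⊙₂ 𝟙 f) ⊙₂ 𝟙 g) ≫ (asc f g f ⊙₂ 𝟙 g) ≫
      ((𝟙 f ⊙₂ ev) ⊙₂ 𝟙 g) ≫ (run f ⊙₂ 𝟙 g)) ⊗≫
    (lunInvNat η).hom ▷ (ascInv (P.core.one a) f g ≫ ((η ⊙₂ 𝟙 f) ⊙₂ 𝟙 g) ≫ (asc f g f ⊙₂ 𝟙 g) ≫
      ((𝟙 f ⊙₂ ev) ⊙₂ 𝟙 g) ≫ (run f ⊙₂ 𝟙 g)) ⊗≫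
    (lunInv (P.core.one a) ≫ (𝟙 (P.core.one a) ⊙₂ η)) ◁ (ascInvNat η (𝟙 f) (𝟙 g)).inv ▷
      ((asc f g f ⊙₂ 𝟙 g) ≫ ((𝟙 f ⊙₂ ev) ⊙₂ 𝟙 g) ≫ (run f ⊙₂ 𝟙 g)) ⊗≫
    lunInv (P.core.one a) ◁
      (whiskerLeftIso _ (isoComp (Iso.refl η) (compId f g)) ≪≫ interchange η η ≪≫
        whiskerLeftIso _ (isoComp (compId f g).symm (Iso.refl η))).hom ▷
      (ascInv (f ⊙ g) f g ≫ (asc f g f ⊙₂ 𝟙 g) ≫ ((𝟙 f ⊙₂ ev) ⊙₂ 𝟙 g) ≫ (run f ⊙₂ 𝟙 g)) ⊗≫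
    (lunInvIsoRunInv P a).hom ▷ ((η ⊙₂ 𝟙 (P.core.one a)) ≫ ((𝟙 f ⊙₂ 𝟙 g) ⊙₂ η) ≫
      ascInv (f ⊙ g) f g ≫ (asc f g f ⊙₂ 𝟙 g) ≫ ((𝟙 f ⊙₂ ev) ⊙₂ 𝟙 g) ≫ (run f ⊙₂ 𝟙 g)) ⊗≫
    (runInvNat η).inv ▷ (((𝟙 f ⊙₂ 𝟙 g) ⊙₂ η) ≫
      ascInv (f ⊙ g) f g ≫ (asc f g f ⊙₂ 𝟙 g) ≫ ((𝟙 f ⊙₂ ev) ⊙₂ 𝟙 g) ≫ (run f ⊙₂ 𝟙 g)) ⊗≫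
    (η ≫ runInv (f ⊙ g) ≫ ((𝟙 f ⊙₂ 𝟙 g) ⊙₂ η) ≫ ascInv (f ⊙ g) f g ≫ (asc f g f ⊙₂ 𝟙 g) ≫
      ((𝟙 f ⊙₂ ev) ⊙₂ 𝟙 g)) ◁ (P.mu f g).hom ⊗≫
    (η ≫ runInv (f ⊙ g) ≫ ((𝟙 f ⊙₂ 𝟙 g) ⊙₂ η) ≫ ascInv (f ⊙ g) f g ≫ (asc f g f ⊙₂ 𝟙 g)) ◁
      (ascNat (𝟙 f) ev (𝟙 g)).hom ▷ (𝟙 f ⊙₂ lun g) ⊗≫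
    (η ≫ runInv (f ⊙ g) ≫ ((𝟙 f ⊙₂ 𝟙 g) ⊙₂ η)) ◁ (pentOne f g f g).hom ▷
      ((𝟙 f ⊙₂ (ev ⊙₂ 𝟙 g)) ≫ (𝟙 f ⊙₂ lun g)) ⊗≫
    (η ≫ runInv (f ⊙ g)) ◁ (ascNat (𝟙 f) (𝟙 g) η).hom ▷
      ((𝟙 f ⊙₂ ascInv g f g) ≫ (𝟙 f ⊙₂ (ev ⊙₂ 𝟙 g)) ≫ (𝟙 f ⊙₂ lun g)) ⊗≫
    η ◁ (rhoOne f g).hom ▷ ((𝟙 f ⊙₂ (𝟙 g ⊙₂ η)) ≫ (𝟙 f ⊙₂ ascInv g f g) ≫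
      (𝟙 f ⊙₂ (ev ⊙₂ 𝟙 g)) ≫ (𝟙 f ⊙₂ lun g)) ⊗≫
    η ◁ ((distribL₅ f (runInv g) (𝟙 g ⊙₂ η) (ascInv g f g) (ev ⊙₂ 𝟙 g) (lun g)).symm ≪≫
      isoComp (Iso.refl (𝟙 f)) Θ.symm).hom

/-- A biadjoint biequivalence `(f, inv, epsilon, eta, Φ, Θ)` on a morphism `f`. -/
structure BiadjointBiequivalence (f : P.core.Hom a b) where
  inv : P.core.Hom b a
  epsilon : inv ⊙ f ⟶ P.core.one b
  epsilonInverse : WeakInverse epsilon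
  eta : P.core.one a ⟶ f ⊙ inv
  etaInverse : WeakInverse eta
  Φ : 𝟙 f ≅ zigzag₁ f inv epsilon eta
  Θ : 𝟙 inv ≅ zigzag₂ f inv epsilon eta
  swallowtail_eq : swallowtail f inv epsilon eta Φ Θ = 𝟙 _

end Biadjoint

variable (P) in
/-- Choices of an inverse for every 3-morphism, of a weak inverse for every 2-morphism, and of a
weak inverse, as part of a biadjoint biequivalence, for every morphism. -/
structure InverseData where
  inv₃ : ∀ {a b : P.core.Obj} {f g : P.core.Hom a b} {α β : f ⟶ g}, (α ⟶ β) → (β ⟶ α)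
  comp_inv₃ : ∀ {a b : P.core.Obj} {f g : P.core.Hom a b} {α β : f ⟶ g} (Γ : α ⟶ β),
    Γ ≫ inv₃ Γ = 𝟙 α
  inv₃_comp : ∀ {a b : P.core.Obj} {f g : P.core.Hom a b} {α β : f ⟶ g} (Γ : α ⟶ β),
    inv₃ Γ ≫ Γ = 𝟙 β
  weak₂ : ∀ {a b : P.core.Obj} {f g : P.core.Hom a b} (α : f ⟶ g), WeakInverse α
  weak₁ : ∀ {a b : P.core.Obj} (f : P.core.Hom a b), BiadjointBiequivalence f

end Pretricategory

/-- A finite-dimensional smooth manifold without boundary, Hausdorff and second countable. -/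
structure SmoothManifold where
  Carrier : Type u
  E : Type u
  ModelSpace : Type u
  [normedGroup : NormedAddCommGroup E]
  [normedSpace : NormedSpace ℝ E]
  [finiteDimensional : FiniteDimensional ℝ E]
  [modelTopology : TopologicalSpace ModelSpace]
  [topology : TopologicalSpace Carrier]
  model : ModelWithCorners ℝ E ModelSpace
  [boundaryless : model.Boundaryless]
  [chartedSpace : ChartedSpace ModelSpace Carrier]
  [isManifold : IsManifold model ∞ Carrier]
  [t2 : T2Space Carrier]
  [secondCountable : SecondCountableTopology Carrier]

namespace SmoothManifold

attribute [instance] normedGroup normedSpace finiteDimensional modelTopology topology boundaryless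
  chartedSpace isManifold t2 secondCountable

instance : CoeSort SmoothManifold.{u} (Type u) := ⟨Carrier⟩

/-- The product manifold. -/
noncomputable def prod (M N : SmoothManifold.{u}) : SmoothManifold.{u} where
  Carrier := M.Carrier × N.Carrier
  E := M.E × N.E
  ModelSpace := ModelProd M.ModelSpace N.ModelSpace
  model := M.model.prod N.model
  secondCountable := inferInstanceAs (SecondCountableTopology (M.Carrier × N.Carrier))

/-- Smoothness of a map between manifolds. -/
def Smooth {M N : SmoothManifold.{u}} (φ : M → N) : Prop := ContMDiff M.model N.model ∞ φ

/-- A smooth embedding: a smooth map with injective differentials that is a homeomorphism onto its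
image. -/
structure IsEmbedding {M N : SmoothManifold.{u}} (φ : M → N) : Prop where
  smooth : Smooth φ
  isEmbedding : Topology.IsEmbedding φ
  injective_mfderiv : ∀ x, Function.Injective (mfderiv M.model N.model φ x)

/-- Let `i : D → M` be an injective map from a set to a manifold. `SmoothOn i φ` says that the
image of `i` is an embedded submanifold of `M` and that `φ : D → N` is smooth for the manifold
structure on `D` obtained in this way. It is applied to spaces `D` of composable cells (iterated
pullbacks of source and target maps), seen in a product of manifolds of cells. -/
def SmoothOn {D : Type w} {M N : SmoothManifold.{u}} (i : D → M) (φ : D → N) : Prop :=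
  ∃ (Q : SmoothManifold.{u}) (q : Q ≃ D), IsEmbedding (N := M) (i ∘ q) ∧
    Smooth (M := Q) (N := N) (φ ∘ q)

end SmoothManifold

section Cells

variable (T : TricategoryCore.{v, o, w₁, w₂})

/-- The set of morphisms. -/
structure Cell₁ where
  {a b : T.Obj}
  f : T.Hom a b

/-- The set of 2-morphisms. -/
structure Cell₂ where
  {a b : T.Obj}
  {f g : T.Hom a b}
  α : f ⟶ g

/-- The set of 3-morphisms. -/
structure Cell₃ where
  {a b : T.Obj}
  {f g : T.Hom a b}
  {α β : f ⟶ g}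
  Γ : α ⟶ β

/-- Pairs of 3-morphisms composable at a 2-cell. -/
structure VerticalPair₃ where
  {a b : T.Obj}
  {f g : T.Hom a b}
  {α β γ : f ⟶ g}
  Γ : α ⟶ β
  Γ' : β ⟶ γ

/-- Pairs of 2-morphisms composable at a 1-cell. -/
structure HorizontalPair₂ where
  {a b : T.Obj}
  {f g h : T.Hom a b}
  α : f ⟶ g
  β : g ⟶ h

/-- Pairs of 3-morphisms composable at a 1-cell. -/
structure HorizontalPair₃ where
  {a b : T.Obj}
  {f g h : T.Hom a b}
  {α α' : f ⟶ g}
  {β β' : g ⟶ h}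
  Γ : α ⟶ α'
  Γ' : β ⟶ β'

/-- Triples of 2-morphisms composable at 1-cells. -/
structure HorizontalTriple₂ where
  {a b : T.Obj}
  {f g h k : T.Hom a b}
  α : f ⟶ g
  β : g ⟶ h
  γ : h ⟶ k

/-- Pairs of morphisms composable at a 0-cell. -/
structure Pair₁ where
  {a b c : T.Obj}
  f : T.Hom a b
  g : T.Hom b c

/-- Pairs of 2-morphisms composable at a 0-cell. -/
structure Pair₂ where
  {a b c : T.Obj}
  {f f' : T.Hom a b}
  {g g' : T.Hom b c}
  α : f ⟶ f'
  β : g ⟶ g'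

/-- Pairs of 3-morphisms composable at a 0-cell. -/
structure Pair₃ where
  {a b c : T.Obj}
  {f f' : T.Hom a b}
  {g g' : T.Hom b c}
  {α α' : f ⟶ f'}
  {β β' : g ⟶ g'}
  Γ : α ⟶ α'
  Γ' : β ⟶ β'

/-- Two pairs of 2-morphisms composable at 1-cells which are composable at a 0-cell. -/
structure Quadruple₂ where
  {a b c : T.Obj}
  {f f' f'' : T.Hom a b}
  {g g' g'' : T.Hom b c}
  α : f ⟶ f'
  α' : f' ⟶ f''
  β : g ⟶ g'
  β' : g' ⟶ g''

/-- Triples of morphisms composable at 0-cells. -/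
structure Triple₁ where
  {a b c d : T.Obj}
  f : T.Hom a b
  g : T.Hom b c
  h : T.Hom c d

/-- Triples of 2-morphisms composable at 0-cells. -/
structure Triple₂ where
  {a b c d : T.Obj}
  {f f' : T.Hom a b}
  {g g' : T.Hom b c}
  {h h' : T.Hom c d}
  α : f ⟶ f'
  β : g ⟶ g'
  γ : h ⟶ h'

/-- Quadruples of morphisms composable at 0-cells. -/
structure Quadruple₁ where
  {a b c d e : T.Obj}
  f : T.Hom a b
  g : T.Hom b c
  h : T.Hom c d
  k : T.Hom d e

/-- Manifolds of objects, morphisms, 2-morphisms and 3-morphisms. -/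
structure CellManifolds where
  M₀ : SmoothManifold.{u}
  M₁ : SmoothManifold.{u}
  M₂ : SmoothManifold.{u}
  M₃ : SmoothManifold.{u}
  e₀ : T.Obj ≃ M₀
  e₁ : Cell₁ T ≃ M₁
  e₂ : Cell₂ T ≃ M₂
  e₃ : Cell₃ T ≃ M₃

end Cells

namespace CellManifolds

open SmoothManifold

variable {T : TricategoryCore.{v, o, w₁, w₂}} (S : CellManifolds.{u} T)

/-- The point of the manifold of morphisms given by a morphism. -/
abbrev pt₁ {a b : T.Obj} (f : T.Hom a b) : S.M₁ := S.e₁ ⟨f⟩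

/-- The point of the manifold of 2-morphisms given by a 2-morphism. -/
abbrev pt₂ {a b : T.Obj} {f g : T.Hom a b} (α : f ⟶ g) : S.M₂ := S.e₂ ⟨α⟩

/-- The point of the manifold of 3-morphisms given by a 3-morphism. -/
abbrev pt₃ {a b : T.Obj} {f g : T.Hom a b} {α β : f ⟶ g} (Γ : α ⟶ β) : S.M₃ := S.e₃ ⟨Γ⟩

/-- A family `x d ≅ y d` of invertible 3-morphisms indexed by `D` is smooth, with smooth inverse. -/
def IsoSmoothOn {D : Type w} {M : SmoothManifold.{u}} (i : D → M) {s t : D → T.Obj}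
    {f g : ∀ x, T.Hom (s x) (t x)} {α β : ∀ x, f x ⟶ g x} (Γ : ∀ x, α x ≅ β x) : Prop :=
  SmoothOn (N := S.M₃) i (fun x => S.pt₃ (Γ x).hom) ∧
    SmoothOn (N := S.M₃) i (fun x => S.pt₃ (Γ x).inv)

/-- The inclusions of the spaces of composable cells into products of manifolds of cells. -/
abbrev in₁ (x : Cell₁ T) : S.M₁ := S.pt₁ x.f
abbrev in₂ (x : Cell₂ T) : S.M₂ := S.pt₂ x.α
abbrev in₃ (x : Cell₃ T) : S.M₃ := S.pt₃ x.Γ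
abbrev inV₃ (x : VerticalPair₃ T) : S.M₃.prod S.M₃ := (S.pt₃ x.Γ, S.pt₃ x.Γ')
abbrev inH₂ (x : HorizontalPair₂ T) : S.M₂.prod S.M₂ := (S.pt₂ x.α, S.pt₂ x.β)
abbrev inH₃ (x : HorizontalPair₃ T) : S.M₃.prod S.M₃ := (S.pt₃ x.Γ, S.pt₃ x.Γ')
abbrev inHT₂ (x : HorizontalTriple₂ T) : S.M₂.prod (S.M₂.prod S.M₂) :=
  (S.pt₂ x.α, S.pt₂ x.β, S.pt₂ x.γ)
abbrev inP₁ (x : Pair₁ T) : S.M₁.prod S.M₁ := (S.pt₁ x.f, S.pt₁ x.g)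
abbrev inP₂ (x : Pair₂ T) : S.M₂.prod S.M₂ := (S.pt₂ x.α, S.pt₂ x.β)
abbrev inP₃ (x : Pair₃ T) : S.M₃.prod S.M₃ := (S.pt₃ x.Γ, S.pt₃ x.Γ')
abbrev inQ₂ (x : Quadruple₂ T) : S.M₂.prod (S.M₂.prod (S.M₂.prod S.M₂)) :=
  (S.pt₂ x.α, S.pt₂ x.α', S.pt₂ x.β, S.pt₂ x.β')
abbrev inT₁ (x : Triple₁ T) : S.M₁.prod (S.M₁.prod S.M₁) := (S.pt₁ x.f, S.pt₁ x.g, S.pt₁ x.h)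
abbrev inT₂ (x : Triple₂ T) : S.M₂.prod (S.M₂.prod S.M₂) := (S.pt₂ x.α, S.pt₂ x.β, S.pt₂ x.γ)
abbrev inQ₁ (x : Quadruple₁ T) : S.M₁.prod (S.M₁.prod (S.M₁.prod S.M₁)) :=
  (S.pt₁ x.f, S.pt₁ x.g, S.pt₁ x.h, S.pt₁ x.k)

/-- The morphisms, 2-morphisms and 3-morphisms form a smooth bicategory, with smooth source, target
and identity-assigning maps. -/
structure LocallySmooth : Prop where
  source₁ : SmoothOn S.in₁ (fun x => S.e₀ x.a)
  target₁ : SmoothOn S.in₁ (fun x => S.e₀ x.b)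
  source₂ : SmoothOn S.in₂ (fun x => S.pt₁ x.f)
  target₂ : SmoothOn S.in₂ (fun x => S.pt₁ x.g)
  source₃ : SmoothOn S.in₃ (fun x => S.pt₂ x.α)
  target₃ : SmoothOn S.in₃ (fun x => S.pt₂ x.β)
  one : SmoothOn S.e₀ (fun a => S.pt₁ (T.one a))
  id₂ : SmoothOn S.in₁ (fun x => S.pt₂ (𝟙 x.f))
  id₃ : SmoothOn S.in₂ (fun x => S.pt₃ (𝟙 x.α))
  vertical₃ : SmoothOn S.inV₃ (fun x => S.pt₃ (x.Γ ≫ x.Γ'))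
  horizontal₂ : SmoothOn S.inH₂ (fun x => S.pt₂ (x.α ≫ x.β))
  horizontal₃ : SmoothOn S.inH₃ (fun x => S.pt₃ (x.Γ ▷ x.β ≫ x.α' ◁ x.Γ'))
  associator : S.IsoSmoothOn S.inHT₂ (fun x => α_ x.α x.β x.γ)
  leftUnitor : S.IsoSmoothOn S.in₂ (fun x => λ_ x.α)
  rightUnitor : S.IsoSmoothOn S.in₂ (fun x => ρ_ x.α)

/-- Composition at a 0-cell, the associator and the unitors are smooth. -/
structure CoreSmooth : Prop extends LocallySmooth S where
  comp₁ : SmoothOn S.inP₁ (fun x => S.pt₁ (x.f ⊙ x.g))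
  comp₂ : SmoothOn S.inP₂ (fun x => S.pt₂ (x.α ⊙₂ x.β))
  comp₃ : SmoothOn S.inP₃ (fun x => S.pt₃ (x.Γ ⊙₃ x.Γ'))
  compComp : S.IsoSmoothOn S.inQ₂ (fun x => compComp x.α x.α' x.β x.β')
  compId : S.IsoSmoothOn S.inP₁ (fun x => compId x.f x.g)
  asc : SmoothOn S.inT₁ (fun x => S.pt₂ (asc x.f x.g x.h))
  ascInv : SmoothOn S.inT₁ (fun x => S.pt₂ (ascInv x.f x.g x.h))
  ascNat : S.IsoSmoothOn S.inT₂ (fun x => ascNat x.α x.β x.γ)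
  ascInvNat : S.IsoSmoothOn S.inT₂ (fun x => ascInvNat x.α x.β x.γ)
  ascUnit : S.IsoSmoothOn S.inT₁ (fun x => ascUnit x.f x.g x.h)
  ascCounit : S.IsoSmoothOn S.inT₁ (fun x => ascCounit x.f x.g x.h)
  lun : SmoothOn S.in₁ (fun x => S.pt₂ (lun x.f))
  lunInv : SmoothOn S.in₁ (fun x => S.pt₂ (lunInv x.f))
  lunNat : S.IsoSmoothOn S.in₂ (fun x => lunNat x.α)
  lunInvNat : S.IsoSmoothOn S.in₂ (fun x => lunInvNat x.α)
  lunUnit : S.IsoSmoothOn S.in₁ (fun x => lunUnit x.f)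
  lunCounit : S.IsoSmoothOn S.in₁ (fun x => lunCounit x.f)
  run : SmoothOn S.in₁ (fun x => S.pt₂ (run x.f))
  runInv : SmoothOn S.in₁ (fun x => S.pt₂ (runInv x.f))
  runNat : S.IsoSmoothOn S.in₂ (fun x => runNat x.α)
  runInvNat : S.IsoSmoothOn S.in₂ (fun x => runInvNat x.α)
  runUnit : S.IsoSmoothOn S.in₁ (fun x => runUnit x.f)
  runCounit : S.IsoSmoothOn S.in₁ (fun x => runCounit x.f)

end CellManifolds

open SmoothManifold in
/-- All structure maps of `P` are smooth. -/
structure Pretricategory.IsSmooth (P : Pretricategory.{v, o, w₁, w₂})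
    (S : CellManifolds.{u} P.core) : Prop extends S.CoreSmooth where
  pent : S.IsoSmoothOn S.inQ₁ (fun x => P.pent x.f x.g x.h x.k)
  lam : S.IsoSmoothOn S.inP₁ (fun x => P.lam x.f x.g)
  mu : S.IsoSmoothOn S.inP₁ (fun x => P.mu x.f x.g)
  rho : S.IsoSmoothOn S.inP₁ (fun x => P.rho x.f x.g)

/-- `P`, with the given manifolds of cells, is a smooth tricategory. -/
structure Pretricategory.IsSmoothTricategory (P : Pretricategory.{v, o, w₁, w₂})
    (S : CellManifolds.{u} P.core) : Prop where
  isTricategory : P.IsTricategory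
  isSmooth : P.IsSmooth S

open SmoothManifold in
/-- The choices of inverses depend smoothly on the cells. -/
structure Pretricategory.InverseData.IsSmooth {P : Pretricategory.{v, o, w₁, w₂}}
    (I : P.InverseData) (S : CellManifolds.{u} P.core) : Prop where
  inv₃ : SmoothOn S.in₃ (fun x => S.pt₃ (I.inv₃ x.Γ))
  inv₂ : SmoothOn S.in₂ (fun x => S.pt₂ (I.weak₂ x.α).inv)
  unit₂ : SmoothOn S.in₂ (fun x => S.pt₃ (I.weak₂ x.α).adj.unit)
  counit₂ : SmoothOn S.in₂ (fun x => S.pt₃ (I.weak₂ x.α).adj.counit)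
  inv₁ : SmoothOn S.in₁ (fun x => S.pt₁ (I.weak₁ x.f).inv)
  epsilon : SmoothOn S.in₁ (fun x => S.pt₂ (I.weak₁ x.f).epsilon)
  epsilonInv : SmoothOn S.in₁ (fun x => S.pt₂ (I.weak₁ x.f).epsilonInverse.inv)
  epsilonUnit : SmoothOn S.in₁ (fun x => S.pt₃ (I.weak₁ x.f).epsilonInverse.adj.unit)
  epsilonCounit : SmoothOn S.in₁ (fun x => S.pt₃ (I.weak₁ x.f).epsilonInverse.adj.counit)
  eta : SmoothOn S.in₁ (fun x => S.pt₂ (I.weak₁ x.f).eta)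
  etaInv : SmoothOn S.in₁ (fun x => S.pt₂ (I.weak₁ x.f).etaInverse.inv)
  etaUnit : SmoothOn S.in₁ (fun x => S.pt₃ (I.weak₁ x.f).etaInverse.adj.unit)
  etaCounit : SmoothOn S.in₁ (fun x => S.pt₃ (I.weak₁ x.f).etaInverse.adj.counit)
  Φ : S.IsoSmoothOn S.in₁ (fun x => (I.weak₁ x.f).Φ)
  Θ : S.IsoSmoothOn S.in₁ (fun x => (I.weak₁ x.f).Θ)

/-- A Lie 3-group: a smooth tricategory with one object whose morphisms, 2-morphisms and
3-morphisms are weakly invertible, with a smooth choice of weak inverses. -/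
structure Pretricategory.IsLieThreeGroup (P : Pretricategory.{v, o, w₁, w₂})
    (S : CellManifolds.{u} P.core) : Prop where
  isSmoothTricategory : P.IsSmoothTricategory S
  oneObject : Nonempty (Unique P.core.Obj)
  invertible : ∃ I : P.InverseData, I.IsSmooth S

section Brane

/-- The morphisms of the slim 3-group of `G` and `H`: the elements of `G`. -/
@[ext]
structure BraneHom (G H : Type u) where
  val : G

variable (G H : Type u) [AddCommGroup H]

/-- A category with hom-sets `H`, in which composition is addition. -/
abbrev braneHomCategory (X : Type) : Category.{u} X where
  Hom _ _ := H
  id _ := (0 : H)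
  comp x y := (x + y : H)
  id_comp := zero_add (M := H)
  comp_id := add_zero (M := H)
  assoc := add_assoc (G := H)

/-- An element of `H` as an isomorphism in this category. -/
def homIso {H : Type u} [AddCommGroup H] {X : Type} (x : H) (p q : X) :
    @Iso X (braneHomCategory H X) p q :=
  letI := braneHomCategory H X
  { hom := x
    inv := (-x : H)
    hom_inv_id := add_neg_cancel x
    inv_hom_id := neg_add_cancel x }

/-- The bicategory of morphisms of the slim 3-group. The only 2-morphisms are identities, the
3-morphisms on each of these are the elements of `H`, and composition of 3-morphisms at a 2-cell and
at a 1-cell is addition (so that whiskering with an identity 3-morphism does nothing). -/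
instance braneBicategory : Bicategory.{u, 0} (BraneHom G H) where
  Hom g g' := PLift (g = g')
  id g := ⟨rfl⟩
  comp p q := ⟨p.down.trans q.down⟩
  homCategory g g' := braneHomCategory H (PLift (g = g'))
  whiskerLeft _ _ _ x := x
  whiskerRight x _ := x
  associator _ _ _ := homIso (0 : H) _ _
  leftUnitor _ := homIso (0 : H) _ _
  rightUnitor _ := homIso (0 : H) _ _
  whiskerLeft_id _ _ := rfl
  whiskerLeft_comp _ _ _ _ _ _ := rfl
  id_whiskerLeft x := show (x : H) = 0 + (x + -0) by simp
  comp_whiskerLeft _ _ _ _ x := show (x : H) = 0 + (x + -0) by simp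
  id_whiskerRight _ _ := rfl
  comp_whiskerRight _ _ _ := rfl
  whiskerRight_id x := show (x : H) = 0 + (x + -0) by simp
  whiskerRight_comp x _ _ := show (x : H) = -0 + (x + 0) by simp
  whisker_assoc _ _ _ x _ := show (x : H) = 0 + (x + -0) by simp
  whisker_exchange x y := add_comm (G := H) y x
  pentagon _ _ _ _ := show (0 : H) + (0 + 0) = 0 + 0 by simp
  triangle _ _ := show (0 : H) + 0 = 0 by simp

lemma braneHom_eq {G H : Type u} [AddCommGroup H] {g g' : BraneHom G H} (p : g ⟶ g') :
    g.val = g'.val := by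
  rw [p.down]

variable {G H}

/-- A 3-morphism between two parallel (hence equal) 2-morphisms, as an element of `H`. -/
def braneVal {g g' : BraneHom G H} {p q : g ⟶ g'} (x : p ⟶ q) : H := x

/-- An element of `H`, as an invertible 3-morphism between two parallel 2-morphisms. -/
def braneIso {g g' : BraneHom G H} (p q : g ⟶ g') (x : H) : p ≅ q := homIso x p q

variable (G H)

section

variable {G H} {g g' : BraneHom G H} {p q r : g ⟶ g'}

lemma brane_ext {x y : p ⟶ q} (h : braneVal x = braneVal y) : x = y := h

@[simp] lemma braneVal_id : braneVal (𝟙 p) = 0 := rfl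

@[simp] lemma braneVal_comp (x : p ⟶ q) (y : q ⟶ r) :
    braneVal (x ≫ y) = braneVal x + braneVal y := rfl

@[simp] lemma braneVal_hom (x : H) : braneVal (braneIso p q x).hom = x := rfl

@[simp] lemma braneVal_inv (x : H) : braneVal (braneIso p q x).inv = -x := rfl

@[simp] lemma braneVal_whiskerLeft {g'' : BraneHom G H} (s : g'' ⟶ g) (x : p ⟶ q) :
    braneVal (s ◁ x) = braneVal x := rfl

@[simp] lemma braneVal_whiskerRight {g'' : BraneHom G H} (x : p ⟶ q) (s : g' ⟶ g'') :
    braneVal (x ▷ s) = braneVal x := rfl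

@[simp] lemma brane_associator {g₂ g₃ : BraneHom G H} (s : g' ⟶ g₂) (t : g₂ ⟶ g₃) :
    α_ p s t = braneIso _ _ 0 := rfl

@[simp] lemma brane_leftUnitor : λ_ p = braneIso _ _ 0 := rfl

@[simp] lemma brane_rightUnitor : ρ_ p = braneIso _ _ 0 := rfl

end

variable [Group G] [DistribMulAction G H]

/-- Composition at a 0-cell: multiplication on morphisms and 2-morphisms, and
`(g, x) · (g', x') = (g g', x + g x')` on 3-morphisms. -/
def braneComp : BraneHom G H × BraneHom G H ⥤ᵖ BraneHom G H where
  obj g := ⟨g.1.val * g.2.val⟩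
  map {g g'} p := ⟨by rw [braneHom_eq p.1, braneHom_eq p.2]⟩
  map₂ {g _ _ _} x := (braneVal x.1 + g.1.val • braneVal x.2 : H)
  map₂_id {g _} _ := show (0 : H) + g.1.val • (0 : H) = 0 by simp
  map₂_comp {g _ _ _ _} x y :=
    show (braneVal x.1 + braneVal y.1) + g.1.val • (braneVal x.2 + braneVal y.2) =
      (braneVal x.1 + g.1.val • braneVal x.2) + (braneVal y.1 + g.1.val • braneVal y.2) by
    rw [smul_add]; abel
  mapId _ := braneIso _ _ 0
  mapComp _ _ := braneIso _ _ 0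
  map₂_whisker_left {g g' _} p _ _ x :=
    show braneVal x.1 + g.1.val • braneVal x.2 =
      0 + ((braneVal x.1 + g'.1.val • braneVal x.2) + -0) by
    rw [braneHom_eq p.1]; simp
  map₂_whisker_right {g g' _ _ _} x p :=
    show braneVal x.1 + g.1.val • braneVal x.2 =
      0 + ((braneVal x.1 + g.1.val • braneVal x.2) + -0) by simp
  map₂_associator {g _ _ _} _ _ _ :=
    show (0 : H) + g.1.val • (0 : H) = 0 + (0 + (0 + (-0 + -0))) by simp
  map₂_left_unitor {g _} _ := show (0 : H) + g.1.val • (0 : H) = 0 + (0 + 0) by simp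
  map₂_right_unitor {g _} _ := show (0 : H) + g.1.val • (0 : H) = 0 + (0 + 0) by simp

section

variable {G H}

@[simp] lemma braneVal_comp_map₂ {g g' : BraneHom G H × BraneHom G H} {p q : g ⟶ g'} (x : p ⟶ q) :
    braneVal ((braneComp G H).map₂ x) = braneVal x.1 + g.1.val • braneVal x.2 := rfl

@[simp] lemma braneComp_mapId (g : BraneHom G H × BraneHom G H) :
    (braneComp G H).mapId g = braneIso _ _ 0 := rfl

@[simp] lemma braneComp_mapComp {g g' g'' : BraneHom G H × BraneHom G H} (p : g ⟶ g')
    (q : g' ⟶ g'') : (braneComp G H).mapComp p q = braneIso _ _ 0 := rfl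

end

section

variable {G H} {g g' g'' : BraneHom G H × BraneHom G H × BraneHom G H}

lemma assocLeft_mapId :
    braneVal ((assocLeft (braneComp G H) (braneComp G H)).mapId g).hom = 0 :=
  show ((((0 : H) + g.1.val • (0 + 0)) + 0) + (g.1.val * g.2.1.val) • (0 + 0)) + 0 = (0 : H) by simp

lemma assocRight_mapId :
    braneVal ((assocRight (braneComp G H) (braneComp G H)).mapId g).hom = 0 :=
  show ((0 : H) + g.1.val • ((0 + g.2.1.val • 0) + 0)) + 0 = (0 : H) by simp

lemma assocLeft_mapComp (p : g ⟶ g') (q : g' ⟶ g'') :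
    braneVal ((assocLeft (braneComp G H) (braneComp G H)).mapComp p q).hom = 0 :=
  show ((((0 : H) + g.1.val • (0 + 0)) + 0) + (g.1.val * g.2.1.val) • (0 + 0)) + 0 = (0 : H) by simp

lemma assocRight_mapComp (p : g ⟶ g') (q : g' ⟶ g'') :
    braneVal ((assocRight (braneComp G H) (braneComp G H)).mapComp p q).hom = 0 :=
  show ((0 : H) + g.1.val • ((0 + g.2.1.val • 0) + 0)) + 0 = (0 : H) by simp

end

/-- The trivial associator. -/
def braneAssoc : assocLeft (braneComp G H) (braneComp G H) ≌
    assocRight (braneComp G H) (braneComp G H) where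
  hom :=
    { app := fun g => ⟨congrArg BraneHom.mk (mul_assoc g.1.val g.2.1.val g.2.2.val)⟩
      naturality := fun _ => braneIso _ _ 0
      naturality_naturality := fun {g _ _ _} x =>
        show (braneVal x.1 + g.1.val • braneVal x.2.1) +
          (g.1.val * g.2.1.val) • braneVal x.2.2 + 0 = 0 + (braneVal x.1 +
            g.1.val • (braneVal x.2.1 + g.2.1.val • braneVal x.2.2)) by
        rw [smul_add, mul_smul]; abel
      naturality_id := fun g =>
        show 0 + braneVal ((assocRight (braneComp G H) (braneComp G H)).mapId g).hom =
          braneVal ((assocLeft (braneComp G H) (braneComp G H)).mapId g).hom + (0 + -0) by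
        rw [assocLeft_mapId, assocRight_mapId]; simp
      naturality_comp := fun p q =>
        show 0 + braneVal ((assocRight (braneComp G H) (braneComp G H)).mapComp p q).hom =
          braneVal ((assocLeft (braneComp G H) (braneComp G H)).mapComp p q).hom +
            (0 + (0 + (-0 + (0 + 0)))) by
        rw [assocLeft_mapComp, assocRight_mapComp]; simp }
  inv :=
    { app := fun g => ⟨congrArg BraneHom.mk (mul_assoc g.1.val g.2.1.val g.2.2.val).symm⟩
      naturality := fun _ => braneIso _ _ 0
      naturality_naturality := fun {g _ _ _} x =>
        show (braneVal x.1 +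
            g.1.val • (braneVal x.2.1 + g.2.1.val • braneVal x.2.2)) + 0 =
          0 + ((braneVal x.1 + g.1.val • braneVal x.2.1) +
          (g.1.val * g.2.1.val) • braneVal x.2.2) by
        rw [smul_add, mul_smul]; abel
      naturality_id := fun g =>
        show 0 + braneVal ((assocLeft (braneComp G H) (braneComp G H)).mapId g).hom =
          braneVal ((assocRight (braneComp G H) (braneComp G H)).mapId g).hom + (0 + -0) by
        rw [assocLeft_mapId, assocRight_mapId]; simp
      naturality_comp := fun p q =>
        show 0 + braneVal ((assocLeft (braneComp G H) (braneComp G H)).mapComp p q).hom =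
          braneVal ((assocRight (braneComp G H) (braneComp G H)).mapComp p q).hom +
            (0 + (0 + (-0 + (0 + 0)))) by
        rw [assocLeft_mapComp, assocRight_mapComp]; simp }
  unit := Pseudofunctor.StrongTrans.isoMk (fun _ => braneIso _ _ 0)
    (fun _ => show (0 : H) + (-0 + (0 + (0 + (0 + -0)))) = (0 + -0) + 0 by simp)
  counit := Pseudofunctor.StrongTrans.isoMk (fun _ => braneIso _ _ 0)
    (fun _ => show (0 : H) + (0 + -0) = (-0 + (0 + (0 + (0 + -0)))) + 0 by simp)
  left_triangle := by
    ext g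
    refine brane_ext ?_
    simp [leftZigzag, bicategoricalComp]
    exact (show (0 : H) = 0 + -0 by simp)

/-- The trivial left unitor. -/
def braneLunit : (insertLeft (B := BraneHom G H) ⟨1⟩).comp (braneComp G H) ≌
    Pseudofunctor.id (BraneHom G H) where
  hom :=
    { app := fun g => ⟨congrArg BraneHom.mk (one_mul g.val)⟩
      naturality := fun _ => braneIso _ _ 0
      naturality_naturality := fun {g _ _ _} x =>
        show ((0 : H) + (1 : G) • braneVal x) + 0 = 0 + braneVal x by simp
      naturality_id := fun g =>
        show (0 : H) + 0 = (((0 : H) + (1 : G) • (0 : H)) + 0) + (0 + -0) by simp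
      naturality_comp := fun p q =>
        show (0 : H) + 0 = (((-0 : H) + (1 : G) • (0 : H)) + 0) +
            (0 + (0 + (-0 + (0 + 0)))) by simp }
  inv :=
    { app := fun g => ⟨congrArg BraneHom.mk (one_mul g.val).symm⟩
      naturality := fun _ => braneIso _ _ 0
      naturality_naturality := fun {g _ _ _} x =>
        show braneVal x + 0 = 0 + ((0 : H) + (1 : G) • braneVal x) by simp
      naturality_id := fun g =>
        show (0 : H) + (((0 : H) + (1 : G) • (0 : H)) + 0) = 0 + (0 + -0) by simp
      naturality_comp := fun p q =>
        show (0 : H) + (((-0 : H) + (1 : G) • (0 : H)) + 0) =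
            0 + (0 + (0 + (-0 + (0 + 0)))) by simp }
  unit := Pseudofunctor.StrongTrans.isoMk (fun _ => braneIso _ _ 0)
    (fun _ => show (0 : H) + (-0 + (0 + (0 + (0 + -0)))) = (0 + -0) + 0 by simp)
  counit := Pseudofunctor.StrongTrans.isoMk (fun _ => braneIso _ _ 0)
    (fun _ => show (0 : H) + (0 + -0) = (-0 + (0 + (0 + (0 + -0)))) + 0 by simp)
  left_triangle := by
    ext g
    refine brane_ext ?_
    simp [leftZigzag, bicategoricalComp]
    exact (show (0 : H) = 0 + -0 by simp)

/-- The trivial right unitor. -/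
def braneRunit : (insertRight (A := BraneHom G H) ⟨1⟩).comp (braneComp G H) ≌
    Pseudofunctor.id (BraneHom G H) where
  hom :=
    { app := fun g => ⟨congrArg BraneHom.mk (mul_one g.val)⟩
      naturality := fun _ => braneIso _ _ 0
      naturality_naturality := fun {g _ _ _} x =>
        show (braneVal x + g.val • (0 : H)) + 0 = 0 + braneVal x by simp
      naturality_id := fun g =>
        show (0 : H) + 0 = (((0 : H) + g.val • (0 : H)) + 0) + (0 + -0) by simp
      naturality_comp := fun {g _ _} p q =>
        show (0 : H) + 0 = (((0 : H) + g.val • (-0 : H)) + 0) +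
            (0 + (0 + (-0 + (0 + 0)))) by simp }
  inv :=
    { app := fun g => ⟨congrArg BraneHom.mk (mul_one g.val).symm⟩
      naturality := fun _ => braneIso _ _ 0
      naturality_naturality := fun {g _ _ _} x =>
        show braneVal x + 0 = 0 + (braneVal x + g.val • (0 : H)) by simp
      naturality_id := fun g =>
        show (0 : H) + (((0 : H) + g.val • (0 : H)) + 0) = 0 + (0 + -0) by simp
      naturality_comp := fun {g _ _} p q =>
        show (0 : H) + (((0 : H) + g.val • (-0 : H)) + 0) =
            0 + (0 + (0 + (-0 + (0 + 0)))) by simp }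
  unit := Pseudofunctor.StrongTrans.isoMk (fun _ => braneIso _ _ 0)
    (fun _ => show (0 : H) + (-0 + (0 + (0 + (0 + -0)))) = (0 + -0) + 0 by simp)
  counit := Pseudofunctor.StrongTrans.isoMk (fun _ => braneIso _ _ 0)
    (fun _ => show (0 : H) + (0 + -0) = (-0 + (0 + (0 + (0 + -0)))) + 0 by simp)
  left_triangle := by
    ext g
    refine brane_ext ?_
    simp [leftZigzag, bicategoricalComp]
    exact (show (0 : H) = 0 + -0 by simp)

/-- The slim 3-group without its pentagonator and triangulators. -/
def braneCore : TricategoryCore.{u, 0, u, 0} where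
  Obj := PUnit
  Hom _ _ := BraneHom G H
  one _ := ⟨1⟩
  comp _ _ _ := braneComp G H
  assoc _ _ _ _ := braneAssoc G H
  lunit _ _ := braneLunit G H
  runit _ _ := braneRunit G H

variable {G H}

/-- The slim 3-group of `G` and `H` with pentagonator `π` and trivial triangulators. -/
def brane (π : G → G → G → G → H) : Pretricategory.{u, 0, u, 0} where
  core := braneCore G H
  pent f g h k := braneIso _ _ (π f.val g.val h.val k.val)
  lam _ _ := braneIso _ _ 0
  mu _ _ := braneIso _ _ 0
  rho _ _ := braneIso _ _ 0

section Cells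

variable (G H)

/-- The morphisms are the elements of `G`. -/
def braneCell₁ : Cell₁ (braneCore G H) ≃ G where
  toFun x := BraneHom.val x.f
  invFun g :=
    { a := PUnit.unit
      b := PUnit.unit
      f := BraneHom.mk g }
  left_inv _ := rfl
  right_inv _ := rfl

/-- The 2-morphisms are the identities of the morphisms. -/
def braneCell₂ : Cell₂ (braneCore G H) ≃ G where
  toFun x := BraneHom.val x.f
  invFun g :=
    { a := PUnit.unit
      b := PUnit.unit
      f := BraneHom.mk g
      g := BraneHom.mk g
      α := 𝟙 (BraneHom.mk g : BraneHom G H) }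
  left_inv := by
    rintro ⟨⟨h⟩⟩
    cases h
    rfl
  right_inv _ := rfl

/-- The 3-morphisms are the elements of `G × H`. -/
def braneCell₃ : Cell₃ (braneCore G H) ≃ G × H where
  toFun x := (BraneHom.val x.f, braneVal x.Γ)
  invFun p :=
    { a := PUnit.unit
      b := PUnit.unit
      f := BraneHom.mk p.1
      g := BraneHom.mk p.1
      α := 𝟙 (BraneHom.mk p.1 : BraneHom G H)
      β := 𝟙 (BraneHom.mk p.1 : BraneHom G H)
      Γ := (braneIso (𝟙 (BraneHom.mk p.1 : BraneHom G H)) (𝟙 _) p.2).hom }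
  left_inv := by
    rintro @⟨_, _, f, g, α, β, Γ⟩
    obtain ⟨h⟩ := α
    cases h
    rfl
  right_inv _ := rfl

end Cells

/-- The element of `H` given by an invertible 3-morphism. -/
def isoVal {g g' : BraneHom G H} {p q : g ⟶ g'} (x : p ≅ q) : H := braneVal x.hom

/-- The unit and the counit of a weak inverse of a 2-morphism are trivial. -/
def WeakInverse.IsTrivial {g g' : BraneHom G H} {α : g ⟶ g'} (W : WeakInverse α) : Prop :=
  braneVal W.adj.unit = 0 ∧ braneVal W.adj.counit = 0

end Brane

/-- A manifold in the sense of Mathlib, as a bundled object. -/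
def SmoothManifold.of {E : Type u} [NormedAddCommGroup E] [NormedSpace ℝ E] [FiniteDimensional ℝ E]
    {X : Type u} [TopologicalSpace X] (I : ModelWithCorners ℝ E X) [I.Boundaryless]
    (M : Type u) [TopologicalSpace M] [ChartedSpace X M] [IsManifold I ∞ M] [T2Space M]
    [SecondCountableTopology M] : SmoothManifold.{u} where
  Carrier := M
  E := E
  ModelSpace := X
  model := I

/-- The manifold with one point. -/
noncomputable def SmoothManifold.point : SmoothManifold.{u} :=
  SmoothManifold.of (modelWithCornersSelf ℝ PUnit.{u + 1}) PUnit.{u + 1}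

/-- The manifolds of cells of the slim 3-group of Lie groups `G` and `H`: a point, `G`, `G` and
`G × H`. -/
noncomputable def braneManifolds {E : Type u} [NormedAddCommGroup E] [NormedSpace ℝ E]
    [FiniteDimensional ℝ E] {X : Type u} [TopologicalSpace X] (I : ModelWithCorners ℝ E X)
    [I.Boundaryless] {F : Type u} [NormedAddCommGroup F] [NormedSpace ℝ F] [FiniteDimensional ℝ F]
    {Y : Type u} [TopologicalSpace Y] (J : ModelWithCorners ℝ F Y) [J.Boundaryless]
    (G : Type u) [Group G] [TopologicalSpace G] [ChartedSpace X G] [IsManifold I ∞ G]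
    [T2Space G] [SecondCountableTopology G]
    (H : Type u) [AddCommGroup H] [TopologicalSpace H] [ChartedSpace Y H] [IsManifold J ∞ H]
    [T2Space H] [SecondCountableTopology H] [DistribMulAction G H] :
    CellManifolds.{u} (braneCore G H) where
  M₀ := SmoothManifold.point
  M₁ := SmoothManifold.of I G
  M₂ := SmoothManifold.of I G
  M₃ := (SmoothManifold.of I G).prod (SmoothManifold.of J H)
  e₀ := Equiv.punitEquivPUnit
  e₁ := braneCell₁ G H
  e₂ := braneCell₂ G H
  e₃ := braneCell₃ G H

section Cochains

variable {G : Type*} {H : Type*} [Group G] [AddCommGroup H] [DistribMulAction G H]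

/-- A 4-cochain is normalized if it vanishes whenever one of its arguments is `1`. -/
def IsNormalized (π : G → G → G → G → H) : Prop :=
  ∀ g₁ g₂ g₃ g₄, g₁ = 1 ∨ g₂ = 1 ∨ g₃ = 1 ∨ g₄ = 1 → π g₁ g₂ g₃ g₄ = 0

/-- The coboundary of a 4-cochain. -/
def coboundary (π : G → G → G → G → H) (g₁ g₂ g₃ g₄ g₅ : G) : H :=
  g₁ • π g₂ g₃ g₄ g₅ - π (g₁ * g₂) g₃ g₄ g₅ + π g₁ (g₂ * g₃) g₄ g₅ - π g₁ g₂ (g₃ * g₄) g₅ +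
    π g₁ g₂ g₃ (g₄ * g₅) - π g₁ g₂ g₃ g₄

/-- A 4-cocycle is a 4-cochain with vanishing coboundary. -/
def IsCocycle (π : G → G → G → G → H) : Prop :=
  ∀ g₁ g₂ g₃ g₄ g₅, coboundary π g₁ g₂ g₃ g₄ g₅ = 0

end Cochains

end Tricat

/-! Between any two parallel 2-morphisms the 3-morphisms are the elements of the abelian group $H$,
so a 3-morphism is known from its value `val₃` in $H$. Composition at a 2-cell and at a 1-cell adds
values, and whiskering by a 2-morphism changes nothing. Only composition at a 0-cell is twisted: a
3-morphism with `f` on its left is acted on by the group element `elt f`. All constraint cells have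
value 0 except the pentagonator. Hence a pasting diagram evaluates to the signed sum of its
pentagonators and of the given 3-morphisms in it, each acted on by what stands to its left, and
every axiom becomes an equation in $H$.

On the associahedron each side carries three pentagonators; front minus back is exactly $d\pi$,
which is `pentagonatorIdentity_iff`. Each normalization axiom contains one pentagonator, at
$(f,1,g,h)$ or $(f,g,1,h)$, and $\pi$ vanishes there. The modification axioms hold because a
2-morphism exists only between equal morphisms. By `val₃_swallowtail` the swallowtail of $(f,g)$ has
value $\Phi+\pi(f,g,f,g)-f\Theta$; for $g=f^{-1}$ and $\Theta=0$ this dictates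
$\Phi=-\pi(f,f^{-1},f,f^{-1})$.

For smoothness, the 2-morphisms being identities, each space of composable cells is a product of
copies of $G$ and $H$, and it sits in the product of cell manifolds with a smooth retraction onto it
(`Parametrization`), hence as an embedded submanifold. In these coordinates every structure map is
assembled from multiplication, inversion, addition, the action and $\pi$. -/

namespace Tricat

open TricategoryCore Pretricategory

/-! ### Values of 3-morphisms in $H$ -/

section BraneValues

variable {G H : Type u} [AddCommGroup H] [Group G] [DistribMulAction G H]
  {π : G → G → G → G → H} {a b c d e : (brane π).core.Obj}

/-- The element of `G` given by a morphism of the slim 3-group. -/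
def elt (f : (brane π).core.Hom a b) : G := BraneHom.val (H := H) f

/-- The element of `H` given by a 3-morphism of the slim 3-group. -/
def val₃ {f g : (brane π).core.Hom a b} {α β : f ⟶ g} (Γ : α ⟶ β) : H :=
  braneVal (G := G) Γ

section Local

variable {f g h k : (brane π).core.Hom a b}

/-- The type of 3-morphisms between parallel 2-morphisms is $H$ itself and `val₃` is the identity
map, so nothing is lost by passing to values. -/
lemma val₃_ext {α β : f ⟶ g} {Γ Γ' : α ⟶ β} (h : val₃ Γ = val₃ Γ') : Γ = Γ' := h

lemma val₃_ext_iff {α β : f ⟶ g} {Γ Γ' : α ⟶ β} : Γ = Γ' ↔ val₃ Γ = val₃ Γ' := Iff.rfl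

lemma elt_eq (α : f ⟶ g) : elt f = elt g := braneHom_eq (G := G) (H := H) α

@[simp] lemma val₃_id (α : f ⟶ g) : val₃ (𝟙 α) = 0 := rfl

@[simp] lemma val₃_comp {α β γ : f ⟶ g} (Γ : α ⟶ β) (Γ' : β ⟶ γ) :
    val₃ (Γ ≫ Γ') = val₃ Γ + val₃ Γ' := rfl

-- For an arbitrary isomorphism the inverse is not given by negation definitionally; it follows from
-- uniqueness of inverses in $H$. Thanks to this rule only the `hom` parts of constraint cells need
-- to be evaluated.
@[simp] lemma val₃_inv {α β : f ⟶ g} (Γ : α ≅ β) : val₃ Γ.inv = -val₃ Γ.hom :=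
  eq_neg_of_add_eq_zero_right (congrArg val₃ Γ.hom_inv_id)

@[simp] lemma val₃_whiskerLeft (α : f ⟶ g) {β γ : g ⟶ h} (Γ : β ⟶ γ) :
    val₃ (α ◁ Γ) = val₃ Γ := rfl

@[simp] lemma val₃_whiskerRight {β γ : f ⟶ g} (Γ : β ⟶ γ) (α : g ⟶ h) :
    val₃ (Γ ▷ α) = val₃ Γ := rfl

@[simp] lemma val₃_associator (α : f ⟶ g) (β : g ⟶ h) (γ : h ⟶ k) :
    val₃ (α_ α β γ).hom = 0 := rfl

@[simp] lemma val₃_leftUnitor (α : f ⟶ g) : val₃ (λ_ α).hom = 0 := rfl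

@[simp] lemma val₃_rightUnitor (α : f ⟶ g) : val₃ (ρ_ α).hom = 0 := rfl

-- The coherence isomorphism inserted by `⊗≫` is kept as a term here. In each use it is built from
-- identities, associators, unitors and whiskerings, so the other evaluation rules turn it into 0.
@[simp] lemma val₃_bicategoricalComp {α β γ δ : f ⟶ g} [BicategoricalCoherence β γ]
    (Γ : α ⟶ β) (Γ' : γ ⟶ δ) :
    val₃ (Γ ⊗≫ Γ') = val₃ Γ + (val₃ (BicategoricalCoherence.iso (f := β) (g := γ)).hom + val₃ Γ') :=
  rfl

end Local

section Products

variable {f f' f'' : (brane π).core.Hom a b} {g g' g'' : (brane π).core.Hom b c}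

-- This is the one basic evaluation rule through which the action of $G$ on $H$ enters; every later
-- occurrence of `•` descends from it.
@[simp] lemma val₃_isoComp {α α' : f ⟶ f'} {β β' : g ⟶ g'} (Γ : α ≅ α') (Γ' : β ≅ β') :
    val₃ (isoComp Γ Γ').hom = val₃ Γ.hom + elt f • val₃ Γ'.hom := rfl

@[simp] lemma val₃_compComp (α : f ⟶ f') (α' : f' ⟶ f'') (β : g ⟶ g') (β' : g' ⟶ g'') :
    val₃ (compComp α α' β β').hom = 0 := rfl

@[simp] lemma val₃_compId (f : (brane π).core.Hom a b) (g : (brane π).core.Hom b c) :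
    val₃ (compId f g).hom = 0 := rfl

@[simp] lemma elt_comp₁ (f : (brane π).core.Hom a b) (g : (brane π).core.Hom b c) :
    elt (f ⊙ g) = elt f * elt g := rfl

@[simp] lemma elt_one (a : (brane π).core.Obj) : elt ((brane π).core.one a) = 1 := rfl

end Products

/-! ### Values of the coherence cells: only the pentagonator is nontrivial -/

section Coherence

variable {f f' : (brane π).core.Hom a b} {g g' : (brane π).core.Hom b c}
  {h h' : (brane π).core.Hom c d} {k : (brane π).core.Hom d e} (α : f ⟶ f') (β : g ⟶ g')
  (γ : h ⟶ h')

variable (f g h) in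
@[simp] lemma val₃_ascUnit : val₃ (ascUnit f g h).hom = 0 := rfl

variable (f g h) in
@[simp] lemma val₃_ascCounit : val₃ (ascCounit f g h).hom = 0 := rfl

@[simp] lemma val₃_ascNat : val₃ (ascNat α β γ).hom = 0 := rfl

@[simp] lemma val₃_ascInvNat : val₃ (ascInvNat α β γ).hom = 0 := rfl

variable (f) in
@[simp] lemma val₃_lunUnit : val₃ (lunUnit f).hom = 0 := rfl

variable (f) in
@[simp] lemma val₃_lunCounit : val₃ (lunCounit f).hom = 0 := rfl

variable (f) in
@[simp] lemma val₃_runUnit : val₃ (runUnit f).hom = 0 := rfl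

variable (f) in
@[simp] lemma val₃_runCounit : val₃ (runCounit f).hom = 0 := rfl

@[simp] lemma val₃_lunNat : val₃ (lunNat α).hom = 0 := rfl

@[simp] lemma val₃_lunInvNat : val₃ (lunInvNat α).hom = 0 := rfl

@[simp] lemma val₃_runNat : val₃ (runNat α).hom = 0 := rfl

@[simp] lemma val₃_runInvNat : val₃ (runInvNat α).hom = 0 := rfl

variable (f g h k) in
@[simp] lemma val₃_pent :
    val₃ ((brane π).pent f g h k).hom = π (elt f) (elt g) (elt h) (elt k) := rfl

variable (f g) in
@[simp] lemma val₃_lam : val₃ ((brane π).lam f g).hom = 0 := rfl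

variable (f g) in
@[simp] lemma val₃_mu : val₃ ((brane π).mu f g).hom = 0 := rfl

variable (f g) in
@[simp] lemma val₃_rho : val₃ ((brane π).rho f g).hom = 0 := rfl

end Coherence

/-! ### Values of derived cells: distributivity, reversed edges, cancellation -/

section Derived

variable {f f' f'' f₃ f₄ f₅ : (brane π).core.Hom a b} {g g' g'' g₃ g₄ g₅ : (brane π).core.Hom b c}
  {h : (brane π).core.Hom c d}

@[simp] lemma val₃_pasteSquares {x x' y y' z z' : (brane π).core.Hom a b} {p : x ⟶ x'} {q : y ⟶ y'}
    {r : z ⟶ z'} {s : x ⟶ y} {s' : x' ⟶ y'} {t : y ⟶ z} {t' : y' ⟶ z'} (σ : p ≫ s' ≅ s ≫ q)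
    (τ : q ≫ t' ≅ t ≫ r) : val₃ (pasteSquares σ τ).hom = val₃ σ.hom + val₃ τ.hom := by
  simp [pasteSquares]

@[simp] lemma val₃_idSquare (α : f ⟶ f') : val₃ (idSquare α).hom = 0 := by simp [idSquare]

@[simp] lemma val₃_distribR (α : f ⟶ f') (α' : f' ⟶ f'') (g : (brane π).core.Hom b c) :
    val₃ (distribR α α' g).hom = 0 := by simp [distribR]

@[simp] lemma val₃_distribL (f : (brane π).core.Hom a b) (β : g ⟶ g') (β' : g' ⟶ g'') :
    val₃ (distribL f β β').hom = 0 := by simp [distribL]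

@[simp] lemma val₃_distribR₃ (α₁ : f ⟶ f') (α₂ : f' ⟶ f'') (α₃ : f'' ⟶ f₃)
    (g : (brane π).core.Hom b c) : val₃ (distribR₃ α₁ α₂ α₃ g).hom = 0 := by simp [distribR₃]

@[simp] lemma val₃_distribL₃ (f : (brane π).core.Hom a b) (β₁ : g ⟶ g') (β₂ : g' ⟶ g'')
    (β₃ : g'' ⟶ g₃) : val₃ (distribL₃ f β₁ β₂ β₃).hom = 0 := by simp [distribL₃]

@[simp] lemma val₃_distribR₅ (α₁ : f ⟶ f') (α₂ : f' ⟶ f'') (α₃ : f'' ⟶ f₃) (α₄ : f₃ ⟶ f₄)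
    (α₅ : f₄ ⟶ f₅) (g : (brane π).core.Hom b c) :
    val₃ (distribR₅ α₁ α₂ α₃ α₄ α₅ g).hom = 0 := by simp [distribR₅]

@[simp] lemma val₃_distribL₅ (f : (brane π).core.Hom a b) (β₁ : g ⟶ g') (β₂ : g' ⟶ g'')
    (β₃ : g'' ⟶ g₃) (β₄ : g₃ ⟶ g₄) (β₅ : g₄ ⟶ g₅) :
    val₃ (distribL₅ f β₁ β₂ β₃ β₄ β₅).hom = 0 := by simp [distribL₅]

@[simp] lemma val₃_interchange (α : f ⟶ f') (β : g ⟶ g') : val₃ (interchange α β).hom = 0 := by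
  simp [interchange]

@[simp] lemma val₃_squareComp {p₁ p₂ q₁ q₂ : (brane π).core.Hom a b}
    {r₁ r₂ s₁ s₂ : (brane π).core.Hom b c}
    {α : p₁ ⟶ p₂} {α' : q₁ ⟶ q₂} {x : p₁ ⟶ q₁} {x' : p₂ ⟶ q₂}
    {β : r₁ ⟶ r₂} {β' : s₁ ⟶ s₂} {y : r₁ ⟶ s₁} {y' : r₂ ⟶ s₂}
    (σ : α ≫ x' ≅ x ≫ α') (τ : β ≫ y' ≅ y ≫ β') :
    val₃ (squareComp σ τ).hom = val₃ σ.hom + elt p₁ • val₃ τ.hom := by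
  simp [squareComp]

-- Reversing the edges of a cell reverses its sign, up to the values of the unit and counit used to
-- reverse them. The order of the three terms is immaterial because $H$ is commutative.
@[simp] lemma val₃_inverseIso {s t : f ⟶ f'} {s' t' : f' ⟶ f} (e : s' ≫ s ≅ 𝟙 f')
    (n : 𝟙 f ≅ t ≫ t') (φ : s ≅ t) :
    val₃ (inverseIso e n φ).hom = val₃ e.hom + val₃ n.hom - val₃ φ.hom := by
  simp [inverseIso]
  abel

-- The isomorphism `e` is used once in each direction, so its two contributions cancel in the
-- commutative group $H$.
@[simp] lemma val₃_cancelLeft {s : f ⟶ f'} {s' : f' ⟶ f} (e : s' ≫ s ≅ 𝟙 f') {t t' : f' ⟶ f''}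
    (φ : s ≫ t ≅ s ≫ t') : val₃ (cancelLeft e φ).hom = val₃ φ.hom := by
  simp [cancelLeft]

@[simp] lemma val₃_cancelRight {s : f' ⟶ f''} {s' : f'' ⟶ f'} (n : 𝟙 f' ≅ s ≫ s') {t t' : f ⟶ f'}
    (φ : t ≫ s ≅ t' ≫ s) : val₃ (cancelRight n φ).hom = val₃ φ.hom := by
  simp [cancelRight]

@[simp] lemma val₃_compUnit {s : f ⟶ f'} {t : f' ⟶ f''} {s' : f' ⟶ f} {t' : f'' ⟶ f'}
    (m : 𝟙 f ≅ s ≫ s') (n : 𝟙 f' ≅ t ≫ t') :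
    val₃ (compUnit m n).hom = val₃ m.hom + val₃ n.hom := by
  simp [compUnit]

@[simp] lemma val₃_compUnitL (f : (brane π).core.Hom a b) {θ : g ⟶ g'} {θ' : g' ⟶ g}
    (n : 𝟙 g ≅ θ ≫ θ') : val₃ (compUnitL f n).hom = elt f • val₃ n.hom := by
  simp [compUnitL]

variable (π a) in
@[simp] lemma val₃_lunIsoRun : val₃ (lunIsoRun (brane π) a).hom = 0 := by
  simp [lunIsoRun]

variable (π a) in
@[simp] lemma val₃_lunInvIsoRunInv : val₃ (lunInvIsoRunInv (brane π) a).hom = 0 := by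
  simp [lunInvIsoRunInv]

variable (f g) in
@[simp] lemma val₃_lamInv : val₃ (lamInv f g).hom = 0 := by
  simp [lamInv]

variable (f g) in
@[simp] lemma val₃_rhoOne : val₃ (rhoOne f g).hom = 0 := by
  simp [rhoOne]

-- Moving two associators to the other side of the pentagon uses only units and counits of the
-- associator, which have value 0; the pentagonator itself is not inverted, whence the positive
-- sign.
@[simp] lemma val₃_pentOne (f : (brane π).core.Hom a b) (g : (brane π).core.Hom b c)
    (h : (brane π).core.Hom c d) (k : (brane π).core.Hom d e) :
    val₃ (pentOne f g h k).hom = π (elt f) (elt g) (elt h) (elt k) := by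
  simp [pentOne]

end Derived

/-! ### The associahedron and the coboundary -/

section Faces

variable {e' : (brane π).core.Obj} (f : (brane π).core.Hom a b) (g : (brane π).core.Hom b c)
  (h : (brane π).core.Hom c d) (k : (brane π).core.Hom d e) (p : (brane π).core.Hom e e')

@[simp] lemma val₃_pentComp :
    val₃ (pentComp f g h k p).hom = π (elt f) (elt g) (elt h) (elt k) := by
  simp [pentComp]

-- Having `f` on the left of the pentagonator produces the twisted term $g_1\pi(g_2,g_3,g_4,g_5)$ of
-- the coboundary.
@[simp] lemma val₃_compPent :
    val₃ (compPent f g h k p).hom = elt f • π (elt g) (elt h) (elt k) (elt p) := by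
  simp [compPent]

/-- The remaining faces of this side are naturality squares and unit constraints, of value 0. The
three terms are those that carry a minus sign in $d\pi$; the front carries the other three. -/
lemma val₃_associahedronBack : val₃ (associahedronBack f g h k p) =
    π (elt f) (elt g) (elt h) (elt k) + π (elt f) (elt g) (elt h * elt k) (elt p) +
      π (elt f * elt g) (elt h) (elt k) (elt p) := by
  simp [associahedronBack, add_assoc]

lemma val₃_associahedronFront : val₃ (associahedronFront f g h k p) =
    elt f • π (elt g) (elt h) (elt k) (elt p) + π (elt f) (elt g * elt h) (elt k) (elt p) +
      π (elt f) (elt g) (elt h) (elt k * elt p) := by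
  simp [associahedronFront, add_assoc]

lemma pentagonatorIdentity_iff : PentagonatorIdentity f g h k p ↔
    coboundary π (elt f) (elt g) (elt h) (elt k) (elt p) = 0 := by
  -- The equation is turned around so that its difference is front minus back, the sign convention
  -- of `coboundary`.
  rw [PentagonatorIdentity, val₃_ext_iff, val₃_associahedronBack, val₃_associahedronFront,
    eq_comm, ← sub_eq_zero, coboundary]
  refine Eq.congr_left ?_
  abel

end Faces

end BraneValues

end Tricat
namespace Tricat

open TricategoryCore Pretricategory

/-! ### The tricategory axioms and the value of the swallowtail -/

section BraneTricategory

variable {G H : Type u} [AddCommGroup H] [Group G] [DistribMulAction G H]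
  {π : G → G → G → G → H} {a b c d : (brane π).core.Obj}

/-- Since the naturality squares have value 0, the axiom asks that $\pi$ agree at the sources and at
the targets of the four 2-morphisms. These are equal elements of $G$ by `elt_eq`. -/
lemma brane_pentNatural : (brane π).PentNatural := by
  intro a b c d e f f' g g' h h' k k' α β γ δ
  rw [val₃_ext_iff]
  simp [elt_eq α, elt_eq β, elt_eq γ, elt_eq δ]

lemma brane_lamNatural : (brane π).LamNatural := by
  intro a b c f f' g g' α β
  rw [val₃_ext_iff]
  simp

lemma brane_muNatural : (brane π).MuNatural := by
  intro a b c f f' g g' α β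
  rw [val₃_ext_iff]
  simp

lemma brane_rhoNatural : (brane π).RhoNatural := by
  intro a b c f f' g g' α β
  rw [val₃_ext_iff]
  simp

/-- With trivial triangulators and naturality squares, the only face left is the pentagonator at
$(f,1,g,h)$. In the right axiom it is the one at $(f,g,1,h)$. -/
lemma brane_leftNormalization (hnorm : IsNormalized π) (f : (brane π).core.Hom a b)
    (g : (brane π).core.Hom b c) (h : (brane π).core.Hom c d) : LeftNormalization f g h := by
  rw [LeftNormalization, val₃_ext_iff]
  simp [hnorm (elt f) 1 (elt g) (elt h) (by simp)]

lemma brane_rightNormalization (hnorm : IsNormalized π) (f : (brane π).core.Hom a b)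
    (g : (brane π).core.Hom b c) (h : (brane π).core.Hom c d) : RightNormalization f g h := by
  rw [RightNormalization, val₃_ext_iff]
  simp [hnorm (elt f) (elt g) 1 (elt h) (by simp)]

lemma brane_isTricategory (hnorm : IsNormalized π) (hπ : IsCocycle π) :
    (brane π).IsTricategory where
  pentNatural := brane_pentNatural
  lamNatural := brane_lamNatural
  muNatural := brane_muNatural
  rhoNatural := brane_rhoNatural
  pentagonatorIdentity f g h k p := (pentagonatorIdentity_iff f g h k p).2 (hπ _ _ _ _ _)
  leftNormalization := brane_leftNormalization hnorm
  rightNormalization := brane_rightNormalization hnorm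

/-- Three faces survive: $\Phi\cdot 1$, which is untwisted, the pentagonator with reversed edges,
and $1_f\cdot\Theta^{-1}$, which is inverted and twisted by `f`. The formula holds for any `g`, `ev`
and `η`, with no cocycle condition. -/
lemma val₃_swallowtail (f : (brane π).core.Hom a b) (g : (brane π).core.Hom b a)
    (ev : g ⊙ f ⟶ (brane π).core.one b) (η : (brane π).core.one a ⟶ f ⊙ g)
    (Φ : 𝟙 f ≅ zigzag₁ f g ev η) (Θ : 𝟙 g ≅ zigzag₂ f g ev η) :
    val₃ (swallowtail f g ev η Φ Θ) =
      val₃ Φ.hom + π (elt f) (elt g) (elt f) (elt g) - elt f • val₃ Θ.hom := by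
  simp [swallowtail, sub_eq_add_neg, add_assoc]

end BraneTricategory

/-! ### Weak inverses and biadjoint biequivalences -/

section BraneInverses

variable {G H : Type u} [AddCommGroup H]

/-- The weak inverse, with trivial unit and counit, of a 2-morphism of the slim 3-group. -/
def braneWeakInverse {g g' : BraneHom G H} (α : g ⟶ g') : WeakInverse α where
  inv := ⟨α.down.symm⟩
  adj :=
    { unit := (braneIso _ _ (0 : H)).hom
      counit := (braneIso _ _ (0 : H)).hom
      left_triangle := by
        refine brane_ext ?_
        simp [leftZigzag, bicategoricalComp]
        -- What `simp` leaves is, up to unfolding, the equation $0+0=0$ in $H$.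
        exact add_zero (0 : H)
      right_triangle := by
        refine brane_ext ?_
        simp [rightZigzag, bicategoricalComp]
        exact neg_zero }
  unit_isIso := (braneIso _ _ (0 : H)).isIso_hom
  counit_isIso := (braneIso _ _ (0 : H)).isIso_hom

lemma braneWeakInverse_isTrivial {g g' : BraneHom G H} (α : g ⟶ g') :
    (braneWeakInverse α).IsTrivial := ⟨rfl, rfl⟩

variable [Group G] [DistribMulAction G H] (π : G → G → G → G → H)

/-- The biadjoint biequivalence on a morphism `g` of the slim 3-group, with inverse `g⁻¹`, trivial
adjoint equivalences and `Φ = -π(g, g⁻¹, g, g⁻¹)`, `Θ = 0`. -/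
def braneBiadjoint {a b : (brane π).core.Obj} (f : (brane π).core.Hom a b) :
    BiadjointBiequivalence f where
  inv := BraneHom.mk (elt f)⁻¹
  epsilon := ⟨congrArg BraneHom.mk (inv_mul_cancel (elt f))⟩
  epsilonInverse := braneWeakInverse _
  eta := ⟨congrArg BraneHom.mk (mul_inv_cancel (elt f)).symm⟩
  etaInverse := braneWeakInverse _
  Φ := braneIso (G := G) _ _ (-π (elt f) (elt f)⁻¹ (elt f) (elt f)⁻¹)
  Θ := braneIso (G := G) _ _ (0 : H)
  swallowtail_eq := by
    refine val₃_ext ((val₃_swallowtail f _ _ _ _ _).trans ?_)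
    -- Unfolding identifies the element of the chosen inverse with `(elt f)⁻¹`, and $\Phi$ then
    -- cancels the pentagonator.
    change -π (elt f) (elt f)⁻¹ (elt f) (elt f)⁻¹ + π (elt f) (elt f)⁻¹ (elt f) (elt f)⁻¹
      - elt f • (0 : H) = 0
    simp

/-- The choice of inverses in the slim 3-group. -/
def braneInverseData : (brane π).InverseData where
  inv₃ Γ := (-val₃ Γ : H)
  comp_inv₃ Γ := val₃_ext (add_neg_cancel (val₃ Γ))
  inv₃_comp Γ := val₃_ext (neg_add_cancel (val₃ Γ))
  weak₂ α := braneWeakInverse (G := G) (H := H) α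
  weak₁ f := braneBiadjoint π f

end BraneInverses

end Tricat
namespace Tricat

open SmoothManifold

/-! ### Smooth maps between bundled manifolds -/

section Smooth

variable {M N P : SmoothManifold.{u}}

lemma SmoothManifold.Smooth.id : Smooth (M := M) (N := M) id := contMDiff_id

lemma SmoothManifold.Smooth.const (y : N) : Smooth (M := M) (N := N) fun _ => y := contMDiff_const

lemma SmoothManifold.Smooth.fst :
    Smooth (M := M.prod N) (N := M) (Prod.fst : M.Carrier × N.Carrier → M) := contMDiff_fst

lemma SmoothManifold.Smooth.snd :
    Smooth (M := M.prod N) (N := N) (Prod.snd : M.Carrier × N.Carrier → N) := contMDiff_snd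

lemma SmoothManifold.Smooth.comp {ψ : N → P} {φ : M → N} (hψ : Smooth ψ) (hφ : Smooth φ) :
    Smooth (M := M) (N := P) fun x => ψ (φ x) := ContMDiff.comp hψ hφ

lemma SmoothManifold.Smooth.prodMk {φ : M → N} {ψ : M → P} (hφ : Smooth φ) (hψ : Smooth ψ) :
    Smooth (M := M) (N := N.prod P) fun x => (φ x, ψ x) := ContMDiff.prodMk hφ hψ

end Smooth

/-! ### Embedded submanifolds with a smooth retraction -/

section Parametrization

/-- A parametrization of the image of `i : D → M` by a manifold, with a smooth retraction. -/
structure Parametrization {D : Type w} {M : SmoothManifold.{u}} (i : D → M) where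
  Q : SmoothManifold.{u}
  q : Q ≃ D
  r : M → Q
  smooth_incl : Smooth (M := Q) (N := M) (i ∘ q)
  smooth_r : Smooth (M := M) (N := Q) r
  r_incl : ∀ x, r (i (q x)) = x

variable {D : Type w} {M N : SmoothManifold.{u}} {i : D → M}

/-- A continuous left inverse makes the inclusion a homeomorphism onto its image, and the
differential of a smooth left inverse is a left inverse of the differential. -/
lemma Parametrization.isEmbedding (c : Parametrization i) :
    IsEmbedding (M := c.Q) (N := M) (i ∘ c.q) where
  smooth := c.smooth_incl
  isEmbedding := Function.LeftInverse.isEmbedding c.r_incl c.smooth_r.continuous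
    c.smooth_incl.continuous
  injective_mfderiv x := by
    have hr : MDifferentiableAt M.model c.Q.model c.r ((i ∘ c.q) x) :=
      c.smooth_r.mdifferentiable (by simp) _
    have hi : MDifferentiableAt c.Q.model M.model (i ∘ c.q) x :=
      c.smooth_incl.mdifferentiable (by simp) _
    have h := mfderiv_comp x hr hi
    -- The chain rule for $r\circ i=\mathrm{id}$ exhibits the differential of `r` as a left inverse.
    rw [show c.r ∘ (i ∘ c.q) = id from funext c.r_incl, mfderiv_id] at h
    exact Function.LeftInverse.injective fun v => (DFunLike.congr_fun h v).symm

lemma Parametrization.smoothOn (c : Parametrization i) {φ : D → N}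
    (hφ : Smooth (M := c.Q) (N := N) (φ ∘ c.q)) : SmoothOn i φ :=
  ⟨c.Q, c.q, c.isEmbedding, hφ⟩

/-- The parametrization of a manifold by itself. -/
def Parametrization.ofEquiv (e : D ≃ M) : Parametrization (M := M) e where
  Q := M
  q := e.symm
  r := id
  smooth_incl := by
    rw [Equiv.self_comp_symm]
    exact contMDiff_id
  smooth_r := contMDiff_id
  r_incl := e.apply_symm_apply

end Parametrization

/-! ### Smoothness of the slim 3-group -/

section Brane

variable
    {E : Type u} [NormedAddCommGroup E] [NormedSpace ℝ E] [FiniteDimensional ℝ E]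
    {X : Type u} [TopologicalSpace X] (I : ModelWithCorners ℝ E X) [I.Boundaryless]
    {F : Type u} [NormedAddCommGroup F] [NormedSpace ℝ F] [FiniteDimensional ℝ F]
    {Y : Type u} [TopologicalSpace Y] (J : ModelWithCorners ℝ F Y) [J.Boundaryless]
    (G : Type u) [Group G] [TopologicalSpace G] [ChartedSpace X G] [LieGroup I ∞ G]
    [T2Space G] [SecondCountableTopology G]
    (H : Type u) [AddCommGroup H] [TopologicalSpace H] [ChartedSpace Y H] [LieAddGroup J ∞ H]
    [T2Space H] [SecondCountableTopology H]

local notation "MG" => SmoothManifold.of I G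
local notation "MH" => SmoothManifold.of J H

lemma smooth_mul {M : SmoothManifold.{u}} {φ ψ : M → G} (hφ : Smooth (M := M) (N := MG) φ)
    (hψ : Smooth (M := M) (N := MG) ψ) : Smooth (M := M) (N := MG) fun x => (φ x * ψ x : G) :=
  ContMDiff.mul (I := I) (G := G) hφ hψ

lemma smooth_inv {M : SmoothManifold.{u}} {φ : M → G} (hφ : Smooth (M := M) (N := MG) φ) :
    Smooth (M := M) (N := MG) fun x => ((φ x)⁻¹ : G) :=
  ContMDiff.inv (I := I) (G := G) hφ

lemma smooth_add {M : SmoothManifold.{u}} {φ ψ : M → H} (hφ : Smooth (M := M) (N := MH) φ)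
    (hψ : Smooth (M := M) (N := MH) ψ) : Smooth (M := M) (N := MH) fun x => (φ x + ψ x : H) :=
  ContMDiff.add (I := J) (G := H) hφ hψ

lemma smooth_neg {M : SmoothManifold.{u}} {φ : M → H} (hφ : Smooth (M := M) (N := MH) φ) :
    Smooth (M := M) (N := MH) fun x => (-φ x : H) :=
  ContMDiff.neg (I := J) (G := H) hφ

/-- In the cell manifolds a 2- or 3-morphism is recorded by the element of its source 1-morphism.
This map and the following products are those sources for the structure cells; bracketing and
factors 1 are kept as they stand in the source so that the identification is definitional. -/
lemma smooth_mul₂ : Smooth (M := (MG).prod MG) (N := MG) fun p : G × G => (p.1 * p.2 : G) :=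
  smooth_mul I G Smooth.fst Smooth.snd

lemma smooth_mul₃ : Smooth (M := (MG).prod ((MG).prod MG)) (N := MG)
    fun p : G × G × G => (p.1 * p.2.1 * p.2.2 : G) :=
  smooth_mul I G (smooth_mul I G Smooth.fst (Smooth.fst.comp Smooth.snd))
    (Smooth.snd.comp Smooth.snd)

lemma smooth_mul₃' : Smooth (M := (MG).prod ((MG).prod MG)) (N := MG)
    fun p : G × G × G => (p.1 * (p.2.1 * p.2.2) : G) :=
  smooth_mul I G Smooth.fst (smooth_mul I G (Smooth.fst.comp Smooth.snd)
    (Smooth.snd.comp Smooth.snd))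

lemma smooth_mul₄ : Smooth (M := (MG).prod ((MG).prod ((MG).prod MG))) (N := MG)
    fun p : G × G × G × G => (p.1 * p.2.1 * p.2.2.1 * p.2.2.2 : G) :=
  smooth_mul I G (smooth_mul I G (smooth_mul I G Smooth.fst (Smooth.fst.comp Smooth.snd))
    (Smooth.fst.comp (Smooth.snd.comp Smooth.snd))) (Smooth.snd.comp (Smooth.snd.comp Smooth.snd))

lemma smooth_one_mul : Smooth (M := MG) (N := MG) fun g : G => (1 * g : G) :=
  smooth_mul I G (Smooth.const (N := MG) (1 : G)) Smooth.id

lemma smooth_mul_one : Smooth (M := MG) (N := MG) fun g : G => (g * 1 : G) :=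
  smooth_mul I G Smooth.id (Smooth.const (N := MG) (1 : G))

lemma smooth_one_mul_mul :
    Smooth (M := (MG).prod MG) (N := MG) fun p : G × G => (1 * p.1 * p.2 : G) :=
  smooth_mul I G (smooth_mul I G (Smooth.const (N := MG) (1 : G)) Smooth.fst) Smooth.snd

lemma smooth_mul_one_mul :
    Smooth (M := (MG).prod MG) (N := MG) fun p : G × G => (p.1 * 1 * p.2 : G) :=
  smooth_mul I G (smooth_mul I G Smooth.fst (Smooth.const (N := MG) (1 : G))) Smooth.snd

lemma smooth_mul_mul_one :
    Smooth (M := (MG).prod MG) (N := MG) fun p : G × G => (p.1 * p.2 * 1 : G) :=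
  smooth_mul I G (smooth_mul I G Smooth.fst Smooth.snd) (Smooth.const (N := MG) (1 : G))

/-- Meant for the units and counits in the choice of inverses, which are 3-morphisms of value 0. -/
lemma smooth_prodMk_zero {φ : G → G} (hφ : Smooth (M := MG) (N := MG) φ) :
    Smooth (M := MG) (N := (MG).prod MH) fun x => ((φ x, 0) : G × H) :=
  hφ.prodMk (Smooth.const (N := MH) (0 : H))

lemma smooth_inv_id : Smooth (M := MG) (N := MG) fun g : G => (g⁻¹ : G) :=
  smooth_inv I G Smooth.id

lemma smooth_mul_inv : Smooth (M := MG) (N := MG) fun g : G => (g * g⁻¹ : G) :=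
  smooth_mul I G Smooth.id (smooth_inv_id I G)

lemma smooth_inv_mul : Smooth (M := MG) (N := MG) fun g : G => (g⁻¹ * g : G) :=
  smooth_mul I G (smooth_inv_id I G) Smooth.id

variable [DistribMulAction G H]

/-! ### Coordinates on the spaces of composable cells -/

section Equivalences

variable {G H}

/-- The identity 2-morphism of an element of `G`, as a 2-morphism of the slim 3-group. -/
abbrev braneId (g : G) : BraneHom.mk (H := H) g ⟶ BraneHom.mk g := 𝟙 _

/-- An element of `H`, as a 3-morphism of the slim 3-group. -/
abbrev brane₃ (g : G) (x : H) : braneId (H := H) g ⟶ braneId g := x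

variable (G H)

/-- All 2-morphisms involved are the identity of one `g`, so the pair amounts to `g` together with
two elements of $H$. -/
def braneVerticalPair₃ : G × H × H ≃ VerticalPair₃ (braneCore G H) where
  toFun p := { a := PUnit.unit, b := PUnit.unit, Γ := brane₃ p.1 p.2.1, Γ' := brane₃ p.1 p.2.2 }
  invFun x := (BraneHom.val x.f, braneVal x.Γ, braneVal x.Γ')
  left_inv _ := rfl
  right_inv := by
    rintro @⟨_, _, f, g, ⟨h⟩, β, γ, Γ, Γ'⟩
    -- Once source and target are identified, the other 2-morphisms are identities by proof
    -- irrelevance and need no case split.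
    cases h
    rfl

def braneHorizontalPair₂ : G ≃ HorizontalPair₂ (braneCore G H) where
  toFun g := { a := PUnit.unit, b := PUnit.unit, α := braneId (H := H) g, β := braneId g }
  invFun x := BraneHom.val x.f
  left_inv _ := rfl
  right_inv := by
    rintro @⟨_, _, f, g, h, ⟨h₁⟩, ⟨h₂⟩⟩
    cases h₁
    cases h₂
    rfl

def braneHorizontalPair₃ : G × H × H ≃ HorizontalPair₃ (braneCore G H) where
  toFun p := { a := PUnit.unit, b := PUnit.unit, Γ := brane₃ p.1 p.2.1, Γ' := brane₃ p.1 p.2.2 }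
  invFun x := (BraneHom.val x.f, braneVal x.Γ, braneVal x.Γ')
  left_inv _ := rfl
  right_inv := by
    rintro @⟨_, _, f, g, h, ⟨h₁⟩, α', ⟨h₂⟩, β', Γ, Γ'⟩
    cases h₁
    cases h₂
    rfl

def braneHorizontalTriple₂ : G ≃ HorizontalTriple₂ (braneCore G H) where
  toFun g :=
    { a := PUnit.unit, b := PUnit.unit, α := braneId (H := H) g, β := braneId g, γ := braneId g }
  invFun x := BraneHom.val x.f
  left_inv _ := rfl
  right_inv := by
    rintro @⟨_, _, f, g, h, k, ⟨h₁⟩, ⟨h₂⟩, ⟨h₃⟩⟩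
    cases h₁
    cases h₂
    cases h₃
    rfl

def branePair₁ : G × G ≃ Pair₁ (braneCore G H) where
  toFun p :=
    { a := PUnit.unit, b := PUnit.unit, c := PUnit.unit, f := BraneHom.mk p.1,
      g := BraneHom.mk p.2 }
  invFun x := (BraneHom.val x.f, BraneHom.val x.g)
  left_inv _ := rfl
  right_inv _ := rfl

def branePair₂ : G × G ≃ Pair₂ (braneCore G H) where
  toFun p :=
    { a := PUnit.unit, b := PUnit.unit, c := PUnit.unit, α := braneId (H := H) p.1,
      β := braneId (H := H) p.2 }
  invFun x := (BraneHom.val x.f, BraneHom.val x.g)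
  left_inv _ := rfl
  right_inv := by
    rintro @⟨_, _, _, f, f', g, g', ⟨h₁⟩, ⟨h₂⟩⟩
    cases h₁
    cases h₂
    rfl

def branePair₃ : (G × H) × (G × H) ≃ Pair₃ (braneCore G H) where
  toFun p :=
    { a := PUnit.unit, b := PUnit.unit, c := PUnit.unit, Γ := brane₃ p.1.1 p.1.2,
      Γ' := brane₃ p.2.1 p.2.2 }
  invFun x := ((BraneHom.val x.f, braneVal x.Γ), (BraneHom.val x.g, braneVal x.Γ'))
  left_inv _ := rfl
  right_inv := by
    rintro @⟨_, _, _, f, f', g, g', ⟨h₁⟩, α', ⟨h₂⟩, β', Γ, Γ'⟩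
    cases h₁
    cases h₂
    rfl

def braneQuadruple₂ : G × G ≃ Quadruple₂ (braneCore G H) where
  toFun p :=
    { a := PUnit.unit, b := PUnit.unit, c := PUnit.unit, α := braneId (H := H) p.1,
      α' := braneId p.1, β := braneId (H := H) p.2, β' := braneId p.2 }
  invFun x := (BraneHom.val x.f, BraneHom.val x.g)
  left_inv _ := rfl
  right_inv := by
    rintro @⟨_, _, _, f, f', f'', g, g', g'', ⟨h₁⟩, ⟨h₂⟩, ⟨h₃⟩, ⟨h₄⟩⟩
    cases h₁
    cases h₂
    cases h₃
    cases h₄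
    rfl

def braneTriple₁ : G × G × G ≃ Triple₁ (braneCore G H) where
  toFun p :=
    { a := PUnit.unit, b := PUnit.unit, c := PUnit.unit, d := PUnit.unit, f := BraneHom.mk p.1,
      g := BraneHom.mk p.2.1, h := BraneHom.mk p.2.2 }
  invFun x := (BraneHom.val x.f, BraneHom.val x.g, BraneHom.val x.h)
  left_inv _ := rfl
  right_inv _ := rfl

def braneTriple₂ : G × G × G ≃ Triple₂ (braneCore G H) where
  toFun p :=
    { a := PUnit.unit, b := PUnit.unit, c := PUnit.unit, d := PUnit.unit,
      α := braneId (H := H) p.1, β := braneId (H := H) p.2.1, γ := braneId (H := H) p.2.2 }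
  invFun x := (BraneHom.val x.f, BraneHom.val x.g, BraneHom.val x.h)
  left_inv _ := rfl
  right_inv := by
    rintro @⟨_, _, _, _, f, f', g, g', h, h', ⟨h₁⟩, ⟨h₂⟩, ⟨h₃⟩⟩
    cases h₁
    cases h₂
    cases h₃
    rfl

def braneQuadruple₁ : G × G × G × G ≃ Quadruple₁ (braneCore G H) where
  toFun p :=
    { a := PUnit.unit, b := PUnit.unit, c := PUnit.unit, d := PUnit.unit, e := PUnit.unit,
      f := BraneHom.mk p.1, g := BraneHom.mk p.2.1, h := BraneHom.mk p.2.2.1,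
      k := BraneHom.mk p.2.2.2 }
  invFun x := (BraneHom.val x.f, BraneHom.val x.g, BraneHom.val x.h, BraneHom.val x.k)
  left_inv _ := rfl
  right_inv _ := rfl

end Equivalences

-- Retractions onto the spaces of composable cells

local notation "S" => braneManifolds I J G H

noncomputable section

/-- Parametrizations of the spaces of composable cells of the slim 3-group. -/
def paramV₃ : Parametrization (CellManifolds.inV₃ S) where
  Q := (MG).prod ((MH).prod MH)
  q := braneVerticalPair₃ G H
  -- The image consists of the points $((g,x),(g,y))$; the retraction drops the second copy of $g$.
  r := fun p : (G × H) × (G × H) => (p.1.1, p.1.2, p.2.2)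
  smooth_incl := (Smooth.fst.prodMk (Smooth.fst.comp Smooth.snd)).prodMk
    (Smooth.fst.prodMk (Smooth.snd.comp Smooth.snd))
  smooth_r := (Smooth.fst.comp Smooth.fst).prodMk
    ((Smooth.snd.comp Smooth.fst).prodMk (Smooth.snd.comp Smooth.snd))
  r_incl _ := rfl

def paramH₂ : Parametrization (CellManifolds.inH₂ S) where
  Q := MG
  q := braneHorizontalPair₂ G H
  r := fun p : G × G => p.1
  smooth_incl := Smooth.id.prodMk Smooth.id
  smooth_r := Smooth.fst
  r_incl _ := rfl

def paramH₃ : Parametrization (CellManifolds.inH₃ S) where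
  Q := (MG).prod ((MH).prod MH)
  q := braneHorizontalPair₃ G H
  r := fun p : (G × H) × (G × H) => (p.1.1, p.1.2, p.2.2)
  smooth_incl := (Smooth.fst.prodMk (Smooth.fst.comp Smooth.snd)).prodMk
    (Smooth.fst.prodMk (Smooth.snd.comp Smooth.snd))
  smooth_r := (Smooth.fst.comp Smooth.fst).prodMk
    ((Smooth.snd.comp Smooth.fst).prodMk (Smooth.snd.comp Smooth.snd))
  r_incl _ := rfl

def paramHT₂ : Parametrization (CellManifolds.inHT₂ S) where
  Q := MG
  q := braneHorizontalTriple₂ G H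
  r := fun p : G × G × G => p.1
  smooth_incl := Smooth.id.prodMk (Smooth.id.prodMk Smooth.id)
  smooth_r := Smooth.fst
  r_incl _ := rfl

/-- With a single object all morphisms are composable at the 0-cell, so the image is the whole
product and the retraction is the identity. -/
def paramP₁ : Parametrization (CellManifolds.inP₁ S) where
  Q := (MG).prod MG
  q := branePair₁ G H
  r := id
  smooth_incl := Smooth.id
  smooth_r := Smooth.id
  r_incl _ := rfl

def paramP₂ : Parametrization (CellManifolds.inP₂ S) where
  Q := (MG).prod MG
  q := branePair₂ G H
  r := id
  smooth_incl := Smooth.id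
  smooth_r := Smooth.id
  r_incl _ := rfl

def paramP₃ : Parametrization (CellManifolds.inP₃ S) where
  Q := ((MG).prod MH).prod ((MG).prod MH)
  q := branePair₃ G H
  r := id
  smooth_incl := Smooth.id
  smooth_r := Smooth.id
  r_incl _ := rfl

def paramQ₂ : Parametrization (CellManifolds.inQ₂ S) where
  Q := (MG).prod MG
  q := braneQuadruple₂ G H
  -- The image consists of the points $(g,g,g',g')$; the first and third coordinates recover
  -- $(g,g')$.
  r := fun p : G × G × G × G => (p.1, p.2.2.1)
  smooth_incl := Smooth.fst.prodMk
    (Smooth.fst.prodMk (Smooth.snd.prodMk Smooth.snd))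
  smooth_r := Smooth.fst.prodMk (Smooth.fst.comp (Smooth.snd.comp Smooth.snd))
  r_incl _ := rfl

def paramT₁ : Parametrization (CellManifolds.inT₁ S) where
  Q := (MG).prod ((MG).prod MG)
  q := braneTriple₁ G H
  r := id
  smooth_incl := Smooth.id
  smooth_r := Smooth.id
  r_incl _ := rfl

def paramT₂ : Parametrization (CellManifolds.inT₂ S) where
  Q := (MG).prod ((MG).prod MG)
  q := braneTriple₂ G H
  r := id
  smooth_incl := Smooth.id
  smooth_r := Smooth.id
  r_incl _ := rfl

def paramQ₁ : Parametrization (CellManifolds.inQ₁ S) where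
  Q := (MG).prod ((MG).prod ((MG).prod MG))
  q := braneQuadruple₁ G H
  r := id
  smooth_incl := Smooth.id
  smooth_r := Smooth.id
  r_incl _ := rfl

def param₁ : Parametrization (CellManifolds.in₁ S) := .ofEquiv (M := MG) (braneCell₁ G H)

def param₂ : Parametrization (CellManifolds.in₂ S) := .ofEquiv (M := MG) (braneCell₂ G H)

def param₃ : Parametrization (CellManifolds.in₃ S) :=
  .ofEquiv (M := (MG).prod MH) (braneCell₃ G H)

def param₀ : Parametrization (M := (braneManifolds I J G H).M₀) (braneManifolds I J G H).e₀ :=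
  .ofEquiv _

variable {I J G H} in
/-- A family of invertible 3-morphisms of the slim 3-group is smooth if its source 1-morphism and
its value in `H` are. -/
lemma Parametrization.isoSmoothOn {D : Type w} {M : SmoothManifold.{u}} {i : D → M}
    (c : Parametrization i) {s t : D → (braneCore G H).Obj}
    {f g : ∀ x, (braneCore G H).Hom (s x) (t x)} {α β : ∀ x, f x ⟶ g x} {Γ : ∀ x, α x ≅ β x}
    (hG : Smooth (M := c.Q) (N := MG) fun x => BraneHom.val (G := G) (H := H) (f (c.q x)))
    (hH : Smooth (M := c.Q) (N := MH) fun x => braneVal (G := G) (H := H) (Γ (c.q x)).hom) :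
    (S).IsoSmoothOn i Γ :=
  ⟨c.smoothOn (hG.prodMk hH), c.smoothOn <| hG.prodMk <| by
    -- The inverse 3-morphism has the same source 1-morphism and the opposite value, so its
    -- smoothness is that of negation in $H$.
    refine (congrArg (Smooth (M := c.Q) (N := MH)) (funext fun x => ?_)).mpr (smooth_neg J H hH)
    exact eq_neg_of_add_eq_zero_right (α := H)
      (congrArg (braneVal (G := G) (H := H)) (Γ (c.q x)).hom_inv_id)⟩

variable {I J G H} in
-- For the trivial constraint cells, smoothness reduces to that of the source 1-morphism.
lemma Parametrization.isoSmoothOn_of_eq_zero {D : Type w} {M : SmoothManifold.{u}} {i : D → M}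
    (c : Parametrization i) {s t : D → (braneCore G H).Obj}
    {f g : ∀ x, (braneCore G H).Hom (s x) (t x)} {α β : ∀ x, f x ⟶ g x} {Γ : ∀ x, α x ≅ β x}
    (hG : Smooth (M := c.Q) (N := MG) fun x => BraneHom.val (G := G) (H := H) (f (c.q x)))
    (hΓ : ∀ x, braneVal (G := G) (H := H) (Γ x).hom = 0) : (S).IsoSmoothOn i Γ := by
  refine c.isoSmoothOn hG ?_
  simp only [hΓ]
  exact Smooth.const _

/-! ### Smoothness of the structure maps and of the inverses -/

lemma brane_locallySmooth : (S).LocallySmooth where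
  source₁ := (param₁ I J G H).smoothOn (Smooth.const _)
  target₁ := (param₁ I J G H).smoothOn (Smooth.const _)
  source₂ := (param₂ I J G H).smoothOn Smooth.id
  target₂ := (param₂ I J G H).smoothOn Smooth.id
  source₃ := (param₃ I J G H).smoothOn Smooth.fst
  target₃ := (param₃ I J G H).smoothOn Smooth.fst
  one := (param₀ I J G H).smoothOn (Smooth.const _)
  id₂ := (param₁ I J G H).smoothOn Smooth.id
  id₃ := (param₂ I J G H).smoothOn (Smooth.id.prodMk (Smooth.const (N := MH) (0 : H)))
  vertical₃ := (paramV₃ I J G H).smoothOn (Smooth.fst.prodMk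
    (smooth_add J H (Smooth.fst.comp Smooth.snd) (Smooth.snd.comp Smooth.snd)))
  horizontal₂ := (paramH₂ I J G H).smoothOn Smooth.id
  horizontal₃ := (paramH₃ I J G H).smoothOn (Smooth.fst.prodMk
    (smooth_add J H (Smooth.fst.comp Smooth.snd) (Smooth.snd.comp Smooth.snd)))
  associator := (paramHT₂ I J G H).isoSmoothOn_of_eq_zero Smooth.id fun _ => rfl
  leftUnitor := (param₂ I J G H).isoSmoothOn_of_eq_zero Smooth.id fun _ => rfl
  rightUnitor := (param₂ I J G H).isoSmoothOn_of_eq_zero Smooth.id fun _ => rfl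

/-- The twist in composition at a 0-cell is where smoothness of the action is needed. -/
lemma smooth_comp₃ (hact : ContMDiff (I.prod J) J ∞ (fun p : G × H => p.1 • p.2)) :
    Smooth (M := ((MG).prod MH).prod ((MG).prod MH)) (N := (MG).prod MH)
      fun p : (G × H) × (G × H) => ((p.1.1 * p.2.1, p.1.2 + p.1.1 • p.2.2) : G × H) :=
  (smooth_mul I G (Smooth.fst.comp Smooth.fst) (Smooth.fst.comp Smooth.snd)).prodMk
    (smooth_add J H (Smooth.snd.comp Smooth.fst)
      (Smooth.comp (N := (MG).prod MH) (P := MH) hact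
        ((Smooth.fst.comp Smooth.fst).prodMk (Smooth.snd.comp Smooth.snd))))

lemma brane_coreSmooth (hact : ContMDiff (I.prod J) J ∞ (fun p : G × H => p.1 • p.2)) :
    (S).CoreSmooth where
  toLocallySmooth := brane_locallySmooth I J G H
  comp₁ := (paramP₁ I J G H).smoothOn (smooth_mul₂ I G)
  comp₂ := (paramP₂ I J G H).smoothOn (smooth_mul₂ I G)
  comp₃ := (paramP₃ I J G H).smoothOn (smooth_comp₃ I J G H hact)
  compComp := (paramQ₂ I J G H).isoSmoothOn_of_eq_zero (smooth_mul₂ I G) fun _ => rfl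
  compId := (paramP₁ I J G H).isoSmoothOn_of_eq_zero (smooth_mul₂ I G) fun _ => rfl
  asc := (paramT₁ I J G H).smoothOn (smooth_mul₃ I G)
  ascInv := (paramT₁ I J G H).smoothOn (smooth_mul₃' I G)
  ascNat := (paramT₂ I J G H).isoSmoothOn_of_eq_zero (smooth_mul₃ I G) fun _ => rfl
  ascInvNat := (paramT₂ I J G H).isoSmoothOn_of_eq_zero (smooth_mul₃' I G) fun _ => rfl
  ascUnit := (paramT₁ I J G H).isoSmoothOn_of_eq_zero (smooth_mul₃ I G) fun _ => rfl
  ascCounit := (paramT₁ I J G H).isoSmoothOn_of_eq_zero (smooth_mul₃' I G) fun _ => rfl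
  lun := (param₁ I J G H).smoothOn (smooth_one_mul I G)
  lunInv := (param₁ I J G H).smoothOn Smooth.id
  lunNat := (param₂ I J G H).isoSmoothOn_of_eq_zero
    (smooth_one_mul I G) fun _ => rfl
  lunInvNat := (param₂ I J G H).isoSmoothOn_of_eq_zero Smooth.id fun _ => rfl
  lunUnit := (param₁ I J G H).isoSmoothOn_of_eq_zero
    (smooth_one_mul I G) fun _ => rfl
  lunCounit := (param₁ I J G H).isoSmoothOn_of_eq_zero Smooth.id fun _ => rfl
  run := (param₁ I J G H).smoothOn (smooth_mul_one I G)
  runInv := (param₁ I J G H).smoothOn Smooth.id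
  runNat := (param₂ I J G H).isoSmoothOn_of_eq_zero
    (smooth_mul_one I G) fun _ => rfl
  runInvNat := (param₂ I J G H).isoSmoothOn_of_eq_zero Smooth.id fun _ => rfl
  runUnit := (param₁ I J G H).isoSmoothOn_of_eq_zero
    (smooth_mul_one I G) fun _ => rfl
  runCounit := (param₁ I J G H).isoSmoothOn_of_eq_zero Smooth.id fun _ => rfl

/-- The pentagonator is the only constraint with a nonconstant value, and there smoothness is that
of $\pi$. -/
lemma brane_isSmooth (hact : ContMDiff (I.prod J) J ∞ (fun p : G × H => p.1 • p.2))
    {π : G → G → G → G → H} (hsmooth : ContMDiff (I.prod (I.prod (I.prod I))) J ∞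
      (fun p : G × G × G × G => π p.1 p.2.1 p.2.2.1 p.2.2.2)) :
    (brane π).IsSmooth S where
  toCoreSmooth := brane_coreSmooth I J G H hact
  pent := (paramQ₁ I J G H).isoSmoothOn (smooth_mul₄ I G) hsmooth
  lam := (paramP₁ I J G H).isoSmoothOn_of_eq_zero
    (smooth_one_mul_mul I G) fun _ => rfl
  mu := (paramP₁ I J G H).isoSmoothOn_of_eq_zero
    (smooth_mul_one_mul I G) fun _ => rfl
  rho := (paramP₁ I J G H).isoSmoothOn_of_eq_zero
    (smooth_mul_mul_one I G) fun _ => rfl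

/-- Here $\pi$ enters only in $\Phi$, which is the negative of $\pi$ pulled back along the smooth
map $g\mapsto(g,g^{-1},g,g^{-1})$. -/
lemma brane_inverseData_isSmooth {π : G → G → G → G → H}
    (hsmooth : ContMDiff (I.prod (I.prod (I.prod I))) J ∞
      (fun p : G × G × G × G => π p.1 p.2.1 p.2.2.1 p.2.2.2)) :
    (braneInverseData π).IsSmooth S where
  inv₃ := (param₃ I J G H).smoothOn (Smooth.fst.prodMk (smooth_neg J H Smooth.snd))
  inv₂ := (param₂ I J G H).smoothOn Smooth.id
  unit₂ := (param₂ I J G H).smoothOn (smooth_prodMk_zero I J G H Smooth.id)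
  counit₂ := (param₂ I J G H).smoothOn (smooth_prodMk_zero I J G H Smooth.id)
  inv₁ := (param₁ I J G H).smoothOn (smooth_inv_id I G)
  epsilon := (param₁ I J G H).smoothOn (smooth_inv_mul I G)
  epsilonInv := (param₁ I J G H).smoothOn (Smooth.const _)
  epsilonUnit := (param₁ I J G H).smoothOn (smooth_prodMk_zero I J G H (smooth_inv_mul I G))
  epsilonCounit := (param₁ I J G H).smoothOn
    (smooth_prodMk_zero I J G H (Smooth.const (N := MG) (1 : G)))
  eta := (param₁ I J G H).smoothOn (Smooth.const _)
  etaInv := (param₁ I J G H).smoothOn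
    (smooth_mul_inv I G)
  etaUnit := (param₁ I J G H).smoothOn (smooth_prodMk_zero I J G H (Smooth.const (N := MG) (1 : G)))
  etaCounit := (param₁ I J G H).smoothOn
    (smooth_prodMk_zero I J G H (smooth_mul_inv I G))
  Φ := (param₁ I J G H).isoSmoothOn Smooth.id <| smooth_neg J H <|
    Smooth.comp (M := MG) (N := (MG).prod ((MG).prod ((MG).prod MG))) (P := MH) hsmooth <|
      Smooth.id.prodMk <| (smooth_inv_id I G).prodMk <|
        Smooth.id.prodMk (smooth_inv_id I G)
  Θ := (param₁ I J G H).isoSmoothOn_of_eq_zero (smooth_inv_id I G) fun _ => rfl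

end

end Brane

end Tricat

/-! ### The main theorem -/

theorem mainTheorem3
    {E : Type u} [NormedAddCommGroup E] [NormedSpace ℝ E] [FiniteDimensional ℝ E]
    {X : Type u} [TopologicalSpace X] (I : ModelWithCorners ℝ E X) [I.Boundaryless]
    {F : Type u} [NormedAddCommGroup F] [NormedSpace ℝ F] [FiniteDimensional ℝ F]
    {Y : Type u} [TopologicalSpace Y] (J : ModelWithCorners ℝ F Y) [J.Boundaryless]
    (G : Type u) [Group G] [TopologicalSpace G] [ChartedSpace X G] [LieGroup I ∞ G]
    [T2Space G] [SecondCountableTopology G]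
    (H : Type u) [AddCommGroup H] [TopologicalSpace H] [ChartedSpace Y H] [LieAddGroup J ∞ H]
    [T2Space H] [SecondCountableTopology H]
    [DistribMulAction G H] (hact : ContMDiff (I.prod J) J ∞ (fun p : G × H => p.1 • p.2))
    (π : G → G → G → G → H)
    (hsmooth : ContMDiff (I.prod (I.prod (I.prod I))) J ∞
      (fun p : G × G × G × G => π p.1 p.2.1 p.2.2.1 p.2.2.2))
    (hnorm : Tricat.IsNormalized π) :
    (∀ g₁ g₂ g₃ g₄ g₅ : G,
      Tricat.Pretricategory.PentagonatorIdentity (P := Tricat.brane π)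
          (a := PUnit.unit) (b := PUnit.unit) (c := PUnit.unit) (d := PUnit.unit)
          (e := PUnit.unit) (e' := PUnit.unit)
          (Tricat.BraneHom.mk g₁) (Tricat.BraneHom.mk g₂) (Tricat.BraneHom.mk g₃)
          (Tricat.BraneHom.mk g₄) (Tricat.BraneHom.mk g₅) ↔
        Tricat.coboundary π g₁ g₂ g₃ g₄ g₅ = 0) ∧
    (Tricat.IsCocycle π →
      (Tricat.brane π).IsLieThreeGroup (Tricat.braneManifolds I J G H) ∧
      (∀ α : Tricat.Cell₂ (Tricat.brane π).core, ∃ f : Tricat.Cell₁ (Tricat.brane π).core,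
        α = ⟨𝟙 f.f⟩) ∧
      ∃ K : (Tricat.brane π).InverseData, K.IsSmooth (Tricat.braneManifolds I J G H) ∧
        (∀ (f g : Tricat.BraneHom G H) (α : f ⟶ g),
          (K.weak₂ (a := PUnit.unit) (b := PUnit.unit) α).IsTrivial) ∧
        ∀ g : G, ∃ B : (Tricat.brane π).BiadjointBiequivalence
            (a := PUnit.unit) (b := PUnit.unit) (Tricat.BraneHom.mk g),
          K.weak₁ (a := PUnit.unit) (b := PUnit.unit) (Tricat.BraneHom.mk g) = B ∧
          B.inv = Tricat.BraneHom.mk g⁻¹ ∧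
          B.epsilonInverse.IsTrivial ∧ B.etaInverse.IsTrivial ∧
          Tricat.isoVal B.Φ = -π g g⁻¹ g g⁻¹ ∧
          Tricat.isoVal B.Θ = 0) := by
  refine ⟨fun g₁ g₂ g₃ g₄ g₅ => Tricat.pentagonatorIdentity_iff (π := π) (a := PUnit.unit)
    (b := PUnit.unit) (c := PUnit.unit) (d := PUnit.unit) (e := PUnit.unit) (e' := PUnit.unit)
    (Tricat.BraneHom.mk g₁) (Tricat.BraneHom.mk g₂) (Tricat.BraneHom.mk g₃)
    (Tricat.BraneHom.mk g₄) (Tricat.BraneHom.mk g₅), fun hπ => ⟨?_, ?_, ?_⟩⟩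
  · exact ⟨⟨Tricat.brane_isTricategory hnorm hπ, Tricat.brane_isSmooth I J G H hact hsmooth⟩,
      ⟨inferInstanceAs (Unique PUnit)⟩,
      Tricat.braneInverseData π, Tricat.brane_inverseData_isSmooth I J G H hsmooth⟩
  · rintro @⟨_, _, f, g, ⟨h⟩⟩
    -- A 2-morphism is a proof that its source and target coincide; eliminating it leaves an
    -- identity.
    cases h
    exact ⟨⟨f⟩, rfl⟩
  · exact ⟨Tricat.braneInverseData π, Tricat.brane_inverseData_isSmooth I J G H hsmooth,
      fun _ _ α => Tricat.braneWeakInverse_isTrivial α,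
      fun g => ⟨Tricat.braneBiadjoint π _, rfl, rfl, Tricat.braneWeakInverse_isTrivial _,
        Tricat.braneWeakInverse_isTrivial _, rfl, rfl⟩⟩
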